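/- Graphs are finite and loopless but may have parallel edges; a graph is simple if it has no parallel edges. A plane graph is a graph embedded in the plane without crossings; it is considered through its embedding data: the cyclic order of the edges around each vertex (a rotation system with $|V|-|E|+|F|=2$, where $F$ is the set of faces it determines) and the choice of the outer face. The degree of a face is the number of vertices incident with it, and $\Delta^*(G)$ is the maximum face degree of $G$. A graph is $2$-connected if it has at least two vertices, is connected and has no cut vertex; it is $3$-connected if it has at least four vertices and cannot be disconnected by deleting at most two vertices. A cycle may have length $2$ (two parallel edges). A cycle $C$ of a plane graph $G$ is separating if at least one vertex or edge of $G$ lies inside $C$ and at least one vertex or edge of $G$ lies outside $C$. A plane graph $G$ is a subdivision of a plane graph $R$ if it is obtained from $R$ by a (possibly empty) sequence of operations each replacing an edge $uv$ by a path $u,w,v$ through a new vertex $w$. **Theorem.** Let $G$ be a $2$-connected plane graph with at least four faces. Then at least one of the following holds: (i) $G$ is a subdivision of a simple $3$-connected plane graph; (ii) $G$ contains a separating cycle $C_n$ of length $n \le \Delta^*(G)$. -/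

import Mathlib

universe u

/-- A finite multigraph without loops, given by its vertices, its darts (oriented edges), the source
of a dart and the reversal of a dart. An edge is a pair `{d, rev d}`; parallel edges are allowed. -/
structure Multigraph where
  V : Type u
  D : Type u
  [finV : Finite V]
  [finD : Finite D]
  src : D → V
  rev : D → D
  rev_rev : ∀ d, rev (rev d) = d
  rev_ne : ∀ d, rev d ≠ d
  loopless : ∀ d, src (rev d) ≠ src d

namespace Multigraph

attribute [instance] Multigraph.finV Multigraph.finD

/-- The edge underlying a dart. -/
def edge (G : Multigraph.{u}) (d : G.D) : Sym2 G.D := s(d, G.rev d)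

/-- The set of edges. -/
def edgeSet (G : Multigraph.{u}) : Set (Sym2 G.D) := Set.range G.edge

/-- The underlying simple graph: two vertices are adjacent if some edge joins them. -/
def toSimple (G : Multigraph.{u}) : SimpleGraph G.V where
  Adj x y := ∃ d, G.src d = x ∧ G.src (G.rev d) = y
  symm := ⟨by
    rintro x y ⟨d, rfl, rfl⟩
    exact ⟨G.rev d, rfl, by rw [G.rev_rev]⟩⟩
  loopless := ⟨by
    rintro x ⟨d, rfl, h⟩
    exact G.loopless d h⟩

/-- No two edges are parallel. -/
def IsSimple (G : Multigraph.{u}) : Prop :=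
  ∀ d e, G.src d = G.src e → G.src (G.rev d) = G.src (G.rev e) → d = e

/-- At least two vertices, connected, and no cut vertex. (The two-vertex multigraphs formed by
parallel edges are included.) -/
def IsTwoConnected (G : Multigraph.{u}) : Prop :=
  2 ≤ Nat.card G.V ∧ ∀ S : Set G.V, S.ncard < 2 → (G.toSimple.induce Sᶜ).Connected

/-- At least four vertices, and deleting at most two vertices never disconnects the graph. -/
def IsThreeConnected (G : Multigraph.{u}) : Prop :=
  4 ≤ Nat.card G.V ∧ ∀ S : Set G.V, S.ncard < 3 → (G.toSimple.induce Sᶜ).Connected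

/-- A cycle, as a cyclic sequence of darts: each dart ends where the following one starts, no vertex
is repeated and no edge is used twice. Two parallel edges form a cycle of length two. -/
def IsCycle (G : Multigraph.{u}) (C : Cycle G.D) : Prop :=
  C ≠ Cycle.nil ∧ C.Chain (fun d e => G.src (G.rev d) = G.src e) ∧ (C.map G.src).Nodup ∧
    ∀ d ∈ C, G.rev d ∉ C

end Multigraph

/-- A multigraph embedded in an oriented closed surface, given by its rotation system: `next` lists
the darts leaving each vertex in their cyclic order around that vertex. -/
structure EmbeddedGraph extends Multigraph.{u} where
  next : Equiv.Perm D
  sameCycle_next : ∀ d e, next.SameCycle d e ↔ src d = src e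

namespace EmbeddedGraph

/-- Face tracing: the successor of the dart `d` on the boundary of the face at its side. -/
def facePerm (G : EmbeddedGraph.{u}) : Equiv.Perm G.D :=
  (Function.Involutive.toPerm G.rev G.rev_rev).trans G.next

/-- The faces are the orbits of face tracing. -/
def Face (G : EmbeddedGraph.{u}) : Type u := Quotient (Equiv.Perm.SameCycle.setoid G.facePerm)

/-- The face at the side of the dart `d`; the face on the other side of the same edge is
`G.face (G.rev d)`. -/
def face (G : EmbeddedGraph.{u}) (d : G.D) : G.Face := Quotient.mk _ d

/-- The number of vertices incident with a face. -/
noncomputable def faceDegree (G : EmbeddedGraph.{u}) (f : G.Face) : ℕ :=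
  {v | ∃ d, G.src d = v ∧ G.face d = f}.ncard

/-- The maximum face degree. -/
noncomputable def maxFaceDegree (G : EmbeddedGraph.{u}) : ℕ := ⨆ f : G.Face, G.faceDegree f

end EmbeddedGraph

/-- A connected plane graph (with at least one edge): a connected graph embedded in the sphere, that
is, of Euler characteristic `|V| - |E| + |F| = 2`, with one face chosen as the outer (unbounded)
face. -/
structure PlaneGraph extends EmbeddedGraph.{u} where
  connected : toMultigraph.toSimple.Connected
  euler : Nat.card V + Nat.card toEmbeddedGraph.Face = toMultigraph.edgeSet.ncard + 2
  outer : toEmbeddedGraph.Face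

namespace PlaneGraph

/-- Two faces share an edge that does not belong to `C`. -/
def AdjOff (G : PlaneGraph.{u}) (C : Cycle G.D) (f g : G.Face) : Prop :=
  ∃ d, d ∉ C ∧ G.rev d ∉ C ∧ G.face d = f ∧ G.face (G.rev d) = g

/-- The face `f` lies outside `C`: it can be reached from the outer face without crossing `C`. -/
def FaceOutside (G : PlaneGraph.{u}) (C : Cycle G.D) (f : G.Face) : Prop :=
  Relation.ReflTransGen (G.AdjOff C) G.outer f

/-- The vertices and edges that do not lie on `C` and are incident with a face satisfying `P`. -/
def partOff (G : PlaneGraph.{u}) (C : Cycle G.D) (P : G.Face → Prop) : Set (G.V ⊕ Sym2 G.D) :=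
  {x | (∃ d, x = Sum.inl (G.src d) ∧ G.src d ∉ C.map G.src ∧ P (G.face d)) ∨
    (∃ d, x = Sum.inr (G.edge d) ∧ d ∉ C ∧ G.rev d ∉ C ∧ P (G.face d))}

/-- The set of vertices and edges lying outside `C`. -/
def ext (G : PlaneGraph.{u}) (C : Cycle G.D) : Set (G.V ⊕ Sym2 G.D) :=
  G.partOff C (G.FaceOutside C)

/-- The set of vertices and edges lying inside `C`. -/
def int (G : PlaneGraph.{u}) (C : Cycle G.D) : Set (G.V ⊕ Sym2 G.D) :=
  G.partOff C (fun f => ¬ G.FaceOutside C f)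

/-- A separating cycle: something lies inside it and something lies outside it. -/
def IsSeparatingCycle (G : PlaneGraph.{u}) (C : Cycle G.D) : Prop :=
  G.IsCycle C ∧ (G.int C).Nonempty ∧ (G.ext C).Nonempty

/-- `H` arises from `G` by subdividing one edge, namely the edge of the dart `d`: there is one new
vertex `w` and there are two new darts `a`, `b` leaving `w`, where `a` reverses (what is left of) `d`
and `b` reverses (what is left of) `rev d`. The rotations at the old vertices and the outer face are
kept. -/
def IsEdgeSubdivision (G H : PlaneGraph.{u}) : Prop :=
  ∃ (fV : Option G.V ≃ H.V) (fD : G.D ⊕ Bool ≃ H.D) (d : G.D),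
    let w := fV none
    let a := fD (Sum.inr false)
    let b := fD (Sum.inr true)
    (∀ x, H.src (fD (Sum.inl x)) = fV (some (G.src x))) ∧ H.src a = w ∧ H.src b = w ∧
    H.rev (fD (Sum.inl d)) = a ∧ H.rev (fD (Sum.inl (G.rev d))) = b ∧
    (∀ x, x ≠ d → x ≠ G.rev d → H.rev (fD (Sum.inl x)) = fD (Sum.inl (G.rev x))) ∧
    (∀ x, H.next (fD (Sum.inl x)) = fD (Sum.inl (G.next x))) ∧
    (∀ x, H.face (fD (Sum.inl x)) = H.outer ↔ G.face x = G.outer)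

/-- `G` is a subdivision of `R`: it arises from `R` by a (possibly empty) sequence of subdivisions of
edges. -/
def IsSubdivisionOf (G R : PlaneGraph.{u}) : Prop :=
  Relation.ReflTransGen IsEdgeSubdivision R G

end PlaneGraph

/-! Call a partition of the edges into two parts *degenerate* if the parts share at most two
vertices and each part has at least as many edges as vertices.

If there is a degenerate partition, its parts share exactly two vertices `x` and `y`, and a face
that meets both parts is cut at `x` and `y` into an arc in each part. If more than two faces are
cut, then two of them meet at `x` in corners that are not consecutive, and we pass to the partition
that is cut out by these two. Thus two faces are cut. Their four arcs recombine into two cycles,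
each running along one face and returning along the other, and the shorter of these is no longer
than the average of the two face degrees. It has edges on both sides, unless one of the parts is a
path.

If there is none, two parallel edges cannot occur, because by Euler's formula they would form one
part of such a partition. Hence all vertices of degree two can be suppressed, one after the other.
A separation of the remaining graph by at most two vertices would be degenerate as well, since all
degrees are at least three.

Separation by a cycle is handled over `ZMod 2`: Euler's formula says that every cycle is a sum of
face boundaries.
-/

theorem eq_of_preconnected {V β : Type*} {H : SimpleGraph V} (hH : H.Preconnected) {f : V → β}
    (hf : ∀ ⦃a b⦄, H.Adj a b → f a = f b) (a b : V) : f a = f b := by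
  have hab := (H.reachable_iff_reflTransGen a b).1 (hH a b)
  simpa only [Relation.reflTransGen_eq_self] using hab.lift f hf

namespace Multigraph

theorem rev_injective (G : Multigraph.{u}) : Function.Injective G.rev :=
  Function.Involutive.injective G.rev_rev

theorem edge_eq_iff (G : Multigraph.{u}) (d e : G.D) :
    G.edge d = G.edge e ↔ d = e ∨ d = G.rev e := by
  rw [edge, edge, Sym2.eq_iff]
  refine or_congr (and_iff_left_of_imp (congrArg G.rev)) (and_iff_left_of_imp ?_)
  rintro rfl
  exact G.rev_rev e

section Connectivity

variable {G : Multigraph.{u}}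

theorem mem_of_connected (hG : G.toSimple.Connected) {S : Set G.D}
    (hrev : ∀ d ∈ S, G.rev d ∈ S) (hsrc : ∀ x ∈ S, ∀ y, G.src x = G.src y → y ∈ S)
    {x : G.D} (hx : x ∈ S) (y : G.D) : y ∈ S := by
  have hadj : ∀ ⦃v w⦄, G.toSimple.Adj v w → v ∈ G.src '' S → w ∈ G.src '' S := by
    rintro _ _ ⟨d, rfl, rfl⟩ ⟨z, hz, hzd⟩
    exact ⟨_, hrev d (hsrc z hz d hzd), rfl⟩
  have hxy := eq_of_preconnected hG.preconnected (f := (· ∈ G.src '' S))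
    (fun v w hvw => propext ⟨hadj hvw, hadj hvw.symm⟩) (G.src x) (G.src y)
  obtain ⟨z, hz, hzy⟩ := hxy.mp ⟨x, hx, rfl⟩
  exact hsrc z hz y hzy

theorem mem_of_isTwoConnected (hG : G.IsTwoConnected) {S : Set G.D} (v : G.V)
    (hrev : ∀ d ∈ S, G.rev d ∈ S)
    (hsrc : ∀ x ∈ S, ∀ y, G.src x = G.src y → G.src x ≠ v → y ∈ S)
    {x : G.D} (hx : x ∈ S) (y : G.D) : y ∈ S := by
  have hadj : ∀ ⦃a b⦄, (G.toSimple.induce {v}ᶜ).Adj a b → (a : G.V) ∈ G.src '' S →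
      (b : G.V) ∈ G.src '' S := by
    rintro ⟨_, hd⟩ ⟨_, -⟩ ⟨d, rfl, rfl⟩ ⟨z, hz, hzd⟩
    exact ⟨_, hrev d (hsrc z hz d hzd (hzd.trans_ne hd)), rfl⟩
  have hconst := eq_of_preconnected (hG.2 {v} (by simp)).preconnected
    (f := fun a => (a : G.V) ∈ G.src '' S)
    (fun a b hab => propext ⟨hadj hab, hadj hab.symm⟩)
  have hoff : ∀ d, G.src d = v → G.src (G.rev d) ≠ v := fun d hd h =>
    G.loopless d (h.trans hd.symm)
  obtain ⟨x', hx', hx'v⟩ : ∃ x' ∈ S, G.src x' ≠ v := by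
    by_cases h : G.src x = v
    exacts [⟨_, hrev x hx, hoff x h⟩, ⟨x, hx, h⟩]
  have hmem : ∀ z, G.src z ≠ v → z ∈ S := fun z hz => by
    obtain ⟨z', hz', hz'z⟩ := (hconst ⟨G.src x', hx'v⟩ ⟨G.src z, hz⟩).mp ⟨x', hx', rfl⟩
    exact hsrc z' hz' z hz'z (hz'z.trans_ne hz)
  by_cases h : G.src y = v
  · exact G.rev_rev y ▸ hrev _ (hmem _ (hoff y h))
  · exact hmem y h

end Connectivity

section IncidenceMatrix

variable (G : Multigraph.{u})

theorem edge_mem_edgeSet (d : G.D) : G.edge d ∈ G.edgeSet := ⟨d, rfl⟩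

theorem sum_darts_of_edge [Fintype G.D] [DecidableEq G.D] {M : Type*} [AddCommMonoid M]
    (F : G.D → M) (d : G.D) : ∑ d' with G.edge d' = G.edge d, F d' = F d + F (G.rev d) := by
  have hpair : ({d' | G.edge d' = G.edge d} : Finset G.D) = {d, G.rev d} := by
    ext d'
    simp [G.edge_eq_iff]
  rw [hpair, Finset.sum_pair (G.rev_ne d).symm]

theorem card_darts : Nat.card G.D = 2 * G.edgeSet.ncard := by
  classical
  have := Fintype.ofFinite G.D
  have hfiber : ∀ e ∈ Finset.univ.image G.edge,
      ({d | G.edge d = e} : Finset G.D).card = 2 := by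
    simp only [Finset.mem_image, Finset.mem_univ, true_and, forall_exists_index,
      forall_apply_eq_imp_iff, Finset.card_eq_sum_ones, G.sum_darts_of_edge, implies_true,
      Nat.reduceAdd]
  rw [Nat.card_eq_fintype_card, ← Finset.card_univ, Finset.card_eq_sum_card_image G.edge,
    Finset.sum_const_nat hfiber, mul_comm, edgeSet, ← Set.image_univ, ← Finset.coe_univ,
    ← Finset.coe_image, Set.ncard_coe_finset]

variable [Fintype G.D] [DecidableEq G.D] {α : Type*} [DecidableEq α] (s : G.D → α)

/-- The incidence matrix over `ZMod 2` of the edges against the values of `s` on their two darts: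
the edge-vertex incidence matrix for `s = src`, and that of the dual graph for `s = face`. -/
def incMatrix : Matrix G.edgeSet α (ZMod 2) :=
  Matrix.of fun e a => ∑ d with G.edge d = e, if s d = a then 1 else 0

theorem incMatrix_mulVec [Fintype α] (p : α → ZMod 2) (d : G.D) :
    (G.incMatrix s).mulVec p ⟨_, G.edge_mem_edgeSet d⟩ = p (s d) + p (s (G.rev d)) := by
  simp only [incMatrix, Matrix.mulVec, dotProduct, Matrix.of_apply, Finset.sum_mul]
  rw [Finset.sum_comm]
  simp [G.sum_darts_of_edge (fun d' => p (s d'))]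

theorem incMatrix_transpose_mulVec [Fintype G.edgeSet] (w : G.edgeSet → ZMod 2) (a : α) :
    (G.incMatrix s).transpose.mulVec w a = ∑ d with s d = a, w ⟨_, G.edge_mem_edgeSet d⟩ := by
  simp only [incMatrix, Matrix.mulVec, dotProduct, Matrix.transpose_apply, Matrix.of_apply,
    Finset.sum_mul, Finset.sum_filter]
  rw [Finset.sum_comm]
  refine Finset.sum_congr rfl fun d _ => ?_
  rw [Finset.sum_eq_single ⟨_, G.edge_mem_edgeSet d⟩
    (fun e _ he => by rw [if_neg fun h => he (Subtype.ext h.symm), zero_mul])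
    (fun h => absurd (Finset.mem_univ _) h)]
  simp

theorem finrank_ker_incMatrix_le_one [Fintype α] [Nonempty α]
    (hs : ∀ p : α → ZMod 2, (∀ d, p (s d) = p (s (G.rev d))) → ∀ a b, p a = p b) :
    Module.finrank (ZMod 2) (LinearMap.ker (G.incMatrix s).mulVecLin) ≤ 1 := by
  have hker : ∀ p ∈ LinearMap.ker (G.incMatrix s).mulVecLin, ∀ d,
      p (s d) = p (s (G.rev d)) := fun p hp d => by
    rw [← CharTwo.add_eq_zero, ← G.incMatrix_mulVec]
    exact congrFun hp _
  have hone : (1 : α → ZMod 2) ∈ LinearMap.ker (G.incMatrix s).mulVecLin := by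
    ext ⟨_, d, rfl⟩
    exact (G.incMatrix_mulVec s 1 d).trans (CharTwo.add_self_eq_zero 1)
  obtain ⟨a₀⟩ := ‹Nonempty α›
  refine finrank_le_one ⟨1, hone⟩ fun ⟨p, hp⟩ => ⟨p a₀, Subtype.ext (funext fun a => ?_)⟩
  simpa using hs p (hker p hp) a₀ a

end IncidenceMatrix

end Multigraph

theorem exists_mem_apply_notMem {α : Type*} [Finite α] {σ : Equiv.Perm α} {S : Set α} {x y : α}
    (h : σ.SameCycle x y) (hx : x ∈ S) (hy : y ∉ S) :
    ∃ z ∈ S, σ z ∉ S ∧ σ.SameCycle x z := by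
  by_contra! hS
  obtain ⟨n, rfl⟩ := h.exists_nat_pow_eq
  suffices hmem : ∀ n : ℕ, (σ ^ n) x ∈ S from hy (hmem n)
  intro n
  induction n with
  | zero => exact hx
  | succ n ih =>
    rw [pow_succ', Equiv.Perm.mul_apply]
    by_contra hn
    exact hS _ ih hn (Equiv.Perm.sameCycle_pow_right.2 (Equiv.Perm.SameCycle.refl _ _))

namespace EmbeddedGraph

variable (G : EmbeddedGraph.{u})

instance : Finite G.Face := Quotient.finite _

theorem facePerm_apply (d : G.D) : G.facePerm d = G.next (G.rev d) := rfl

theorem facePerm_rev (d : G.D) : G.facePerm (G.rev d) = G.next d := by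
  rw [G.facePerm_apply, G.rev_rev]

theorem src_next (d : G.D) : G.src (G.next d) = G.src d :=
  (G.sameCycle_next _ _).1
    (Equiv.Perm.sameCycle_apply_left.2 (Equiv.Perm.SameCycle.refl _ _))

theorem src_facePerm (d : G.D) : G.src (G.facePerm d) = G.src (G.rev d) := G.src_next _

theorem face_eq_iff (d e : G.D) : G.face d = G.face e ↔ G.facePerm.SameCycle d e := Quotient.eq

theorem face_facePerm (d : G.D) : G.face (G.facePerm d) = G.face d :=
  (G.face_eq_iff _ _).2 (Equiv.Perm.sameCycle_apply_left.2 (Equiv.Perm.SameCycle.refl _ _))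

theorem face_next (d : G.D) : G.face (G.next d) = G.face (G.rev d) := by
  rw [← G.facePerm_rev, G.face_facePerm]

theorem face_surjective : Function.Surjective G.face := Quotient.mk_surjective

theorem exists_mem_next_notMem {S : Set G.D} {x y : G.D} (hx : x ∈ S) (hy : y ∉ S)
    (h : G.src x = G.src y) : ∃ z ∈ S, G.next z ∉ S ∧ G.src z = G.src x := by
  obtain ⟨z, hz, hz', hxz⟩ := exists_mem_apply_notMem ((G.sameCycle_next _ _).2 h) hx hy
  exact ⟨z, hz, hz', ((G.sameCycle_next _ _).1 hxz).symm⟩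

theorem sum_comp_next [Fintype G.D] [DecidableEq G.V] {M : Type*} [AddCommMonoid M] (F : G.D → M)
    (v : G.V) : ∑ d with G.src d = v, F (G.next d) = ∑ d with G.src d = v, F d := by
  simp only [Finset.sum_filter]
  rw [← Equiv.sum_comp G.next fun d => if G.src d = v then F d else 0]
  simp only [G.src_next]

theorem exists_coboundary_of_face_eq [DecidableEq G.D] {d e : G.D} (h : G.face d = G.face e) :
    ∃ W : G.D → ZMod 2, ∀ z, W (G.facePerm z) + W z =
      (Pi.single d 1 + Pi.single e 1 : G.D → ZMod 2) (G.facePerm z) := by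
  obtain ⟨n, rfl⟩ := ((G.face_eq_iff _ _).1 h).exists_nat_pow_eq
  clear h
  induction n with
  | zero => exact ⟨0, fun z => by simp [CharTwo.add_self_eq_zero]⟩
  | succ n ih =>
    obtain ⟨W, hW⟩ := ih
    refine ⟨W + Pi.single ((G.facePerm ^ n) d) 1, fun z => ?_⟩
    have hshift : (Pi.single ((G.facePerm ^ (n + 1)) d) 1 : G.D → ZMod 2) (G.facePerm z) =
        (Pi.single ((G.facePerm ^ n) d) 1 : G.D → ZMod 2) z := by
      simp only [Pi.single_apply, pow_succ', Equiv.Perm.mul_apply, EmbeddingLike.apply_eq_iff_eq]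
    rw [Pi.add_apply, Pi.add_apply, Pi.add_apply, hshift, add_add_add_comm, hW, Pi.add_apply]
    linear_combination CharTwo.add_self_eq_zero
      ((Pi.single ((G.facePerm ^ n) d) 1 : G.D → ZMod 2) (G.facePerm z))

end EmbeddedGraph

namespace PlaneGraph

variable {G : PlaneGraph.{u}}

theorem mem_of_closed {S : Set G.D} (hrev : ∀ d ∈ S, G.rev d ∈ S)
    (hnext : ∀ d ∈ S, G.next d ∈ S) {x : G.D} (hx : x ∈ S) (y : G.D) : y ∈ S := by
  refine Multigraph.mem_of_connected G.connected hrev (fun a ha b hab => ?_) hx y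
  by_contra hb
  obtain ⟨z, hz, hz', -⟩ := G.exists_mem_next_notMem ha hb hab
  exact hz' (hnext z hz)

theorem eq_of_src_eq_src_rev {β : Type*} {p : G.V → β}
    (hp : ∀ d, p (G.src d) = p (G.src (G.rev d))) (a b : G.V) : p a = p b := by
  refine eq_of_preconnected G.connected.preconnected ?_ a b
  rintro _ _ ⟨d, rfl, rfl⟩
  exact hp d

theorem eq_of_face_eq_face_rev {β : Type*} {p : G.Face → β}
    (hp : ∀ d, p (G.face d) = p (G.face (G.rev d))) (f g : G.Face) : p f = p g := by
  obtain ⟨d, rfl⟩ := G.face_surjective f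
  obtain ⟨e, rfl⟩ := G.face_surjective g
  refine mem_of_closed (S := {z | p (G.face d) = p (G.face z)}) (fun z hz => ?_)
    (fun z hz => ?_) rfl e
  · exact hz.trans (hp z)
  · rw [Set.mem_ofPred_eq, G.face_next]
    exact hz.trans (hp z)

section Potentials

variable [Fintype G.D] [DecidableEq G.V]

theorem range_incMatrix_face_le [DecidableEq G.D] [Fintype G.Face] [DecidableEq G.Face]
    [Fintype G.edgeSet] :
    LinearMap.range (G.incMatrix G.face).mulVecLin ≤
      LinearMap.ker (G.incMatrix G.src).transpose.mulVecLin := by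
  rintro _ ⟨h, rfl⟩
  rw [LinearMap.mem_ker]
  ext v
  simp only [Matrix.mulVecLin_apply, G.incMatrix_transpose_mulVec, G.incMatrix_mulVec,
    Finset.sum_add_distrib, ← G.face_next]
  rw [G.sum_comp_next fun d => h (G.face d)]
  exact CharTwo.add_self_eq_zero _

-- Every cycle over `ZMod 2` is a sum of face boundaries: Euler's formula makes dimensions agree.
theorem range_incMatrix_face [DecidableEq G.D] [Fintype G.Face] [DecidableEq G.Face]
    [Fintype G.edgeSet] :
    LinearMap.range (G.incMatrix G.face).mulVecLin =
      LinearMap.ker (G.incMatrix G.src).transpose.mulVecLin := by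
  have := Fintype.ofFinite G.V
  have : Nonempty G.V := G.connected.nonempty
  have : Nonempty G.Face := ⟨G.outer⟩
  have : Fact (Nat.Prime 2) := ⟨Nat.prime_two⟩
  refine Submodule.eq_of_le_of_finrank_le range_incMatrix_face_le ?_
  have hface := (G.incMatrix G.face).mulVecLin.finrank_range_add_finrank_ker
  have hsrc := (G.incMatrix G.src).mulVecLin.finrank_range_add_finrank_ker
  have hsrc' := (G.incMatrix G.src).transpose.mulVecLin.finrank_range_add_finrank_ker
  have hrank : Module.finrank (ZMod 2) (LinearMap.range (G.incMatrix G.src).transpose.mulVecLin) =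
      Module.finrank (ZMod 2) (LinearMap.range (G.incMatrix G.src).mulVecLin) :=
    (G.incMatrix G.src).rank_transpose
  have hkface := G.finrank_ker_incMatrix_le_one G.face fun _ hp => eq_of_face_eq_face_rev hp
  have hksrc := G.finrank_ker_incMatrix_le_one G.src fun _ hp => eq_of_src_eq_src_rev hp
  have heuler := G.euler
  rw [Nat.card_eq_fintype_card, Nat.card_eq_fintype_card, ← Nat.card_coe_set_eq,
    Nat.card_eq_fintype_card] at heuler
  simp only [Module.finrank_fintype_fun_eq_card] at hface hsrc hsrc'
  lia

theorem exists_facePotential (W : G.D → ZMod 2)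
    (hW : ∀ v, ∑ d with G.src d = v, (W d + W (G.rev d)) = 0) :
    ∃ h : G.Face → ZMod 2, ∀ d, h (G.face d) + h (G.face (G.rev d)) = W d + W (G.rev d) := by
  classical
  have := Fintype.ofFinite G.V
  have := Fintype.ofFinite G.Face
  have := Fintype.ofFinite G.edgeSet
  let w : G.edgeSet → ZMod 2 := fun e => ∑ d with G.edge d = e, W d
  have hw : w ∈ LinearMap.ker (G.incMatrix G.src).transpose.mulVecLin := by
    ext v
    simpa only [w, Matrix.mulVecLin_apply, G.incMatrix_transpose_mulVec, G.sum_darts_of_edge,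
      Pi.zero_apply] using hW v
  rw [← range_incMatrix_face] at hw
  obtain ⟨h, hh⟩ := hw
  refine ⟨h, fun d => ?_⟩
  rw [← G.incMatrix_mulVec, ← Matrix.mulVecLin_apply, hh]
  exact G.sum_darts_of_edge W d

-- `K d` is prescribed on the corner between `next⁻¹ d` and `d`, where a face turns at a vertex.
theorem exists_cornerPotential {K W : G.D → ZMod 2}
    (hW : ∀ d, W (G.facePerm d) + W d = K (G.facePerm d))
    (hK : ∀ v, ∑ d with G.src d = v, K d = 0) :
    ∃ H : G.D → ZMod 2, (∀ d, H (G.rev d) = H d) ∧ ∀ d, H (G.next d) + H d = K (G.next d) := by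
  have hWnext : ∀ d, W (G.next d) + W (G.rev d) = K (G.next d) := fun d => by
    simpa only [G.facePerm_rev] using hW (G.rev d)
  obtain ⟨h, hh⟩ := exists_facePotential W fun v => by
    calc ∑ d with G.src d = v, (W d + W (G.rev d))
        = ∑ d with G.src d = v, (W (G.next d) + W (G.rev d)) := by
          rw [Finset.sum_add_distrib, Finset.sum_add_distrib, G.sum_comp_next]
      _ = ∑ d with G.src d = v, K (G.next d) := by simp only [hWnext]
      _ = 0 := by rw [G.sum_comp_next, hK]
  have hrev : ∀ d, h (G.face (G.rev d)) + W (G.rev d) = h (G.face d) + W d := fun d =>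
    CharTwo.add_eq_zero.1 <| by
      linear_combination hh d + CharTwo.add_self_eq_zero (W d + W (G.rev d))
  refine ⟨fun d => h (G.face d) + W d, hrev, fun d => ?_⟩
  dsimp only
  rw [← hrev d, G.face_next, ← hWnext]
  linear_combination CharTwo.add_self_eq_zero (h (G.face (G.rev d)))

end Potentials

theorem eq_of_face_eq_of_src_eq (hG : G.IsTwoConnected) {d e : G.D} (hf : G.face d = G.face e)
    (hs : G.src d = G.src e) : d = e := by
  classical
  have := Fintype.ofFinite G.D
  by_contra hne
  obtain ⟨W, hW⟩ := G.exists_coboundary_of_face_eq hf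
  obtain ⟨H, hrev, hnext⟩ := exists_cornerPotential hW fun v => by
    simp [Finset.sum_add_distrib, hs, CharTwo.add_self_eq_zero]
  have hconst : ∀ z, H z = H d := by
    refine Multigraph.mem_of_isTwoConnected hG (S := {z | H z = H d}) (G.src d)
      (fun z hz => (hrev z).trans hz) (fun x hx y hxy hxd => ?_) rfl
    by_contra hy
    obtain ⟨z, hz, hz', hzx⟩ := G.exists_mem_next_notMem hx hy hxy
    have hzd : G.next z ≠ d := fun h => hxd (by rw [← hzx, ← h, G.src_next])
    have hze : G.next z ≠ e := fun h => hxd (by rw [← hzx, hs, ← h, G.src_next])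
    refine hz' (Eq.trans (CharTwo.add_eq_zero.1 ((hnext z).trans ?_)) hz)
    simp [hzd, hze]
  have hd := hnext (G.next.symm d)
  simp [hconst, CharTwo.add_self_eq_zero, hne] at hd

theorem next_ne_of_isTwoConnected (hG : G.IsTwoConnected) (hF : 3 ≤ Nat.card G.Face) (d : G.D) :
    G.next d ≠ d := by
  intro hd
  have honly : ∀ y, G.src d = G.src y → y = d := fun y hy => by
    by_contra hne
    obtain ⟨_, rfl, hd', -⟩ := G.exists_mem_next_notMem (S := {d}) rfl hne hy
    exact hd' hd
  have huniv : ∀ y, y ∈ ({d, G.rev d} : Set G.D) := by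
    refine Multigraph.mem_of_isTwoConnected hG (G.src (G.rev d)) ?_ ?_ (Or.inl rfl)
    · rintro _ (rfl | rfl)
      exacts [Or.inr rfl, Or.inl (G.rev_rev d)]
    · rintro _ (rfl | rfl) y hxy hx
      exacts [Or.inl (honly y hxy), absurd rfl hx]
  have hD : Nat.card G.D ≤ 2 := by
    rw [← Set.ncard_univ, ← Set.eq_univ_of_forall huniv]
    exact (Set.ncard_insert_le _ _).trans_eq (by rw [Set.ncard_singleton])
  exact absurd (Nat.card_le_card_of_surjective _ G.face_surjective) (by lia)

end PlaneGraph

section Cycle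

variable {α β : Type*} {C : Cycle α}

theorem isChain_cons_append_singleton_iff {f g : α → β} (a b : α) (l : List α) :
    List.IsChain (fun d e => f d = g e) (a :: (l ++ [b])) ↔
      (a :: l).map f = (l ++ [b]).map g := by
  induction l generalizing a with
  | nil => simp
  | cons c l ih => simp [ih]

theorem map_eq_map_of_chain {f g : α → β} (h : C.Chain fun d e => f d = g e) :
    C.map f = C.map g := by
  induction C using Cycle.induction_on with
  | nil => rfl
  | cons a l _ =>
    rw [Cycle.chain_coe_cons, isChain_cons_append_singleton_iff] at h
    rw [Cycle.map_coe, Cycle.map_coe, h, Cycle.coe_eq_coe]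
    exact List.IsRotated.map (List.isRotated_concat a l) g

theorem chain_imp_of_mem {r s : α → α → Prop} (h : C.Chain r)
    (hrs : ∀ a ∈ C, ∀ b ∈ C, r a b → s a b) : C.Chain s := by
  induction C using Cycle.induction_on with
  | nil => exact Cycle.Chain.nil s
  | cons a l _ =>
    rw [Cycle.chain_coe_cons] at h ⊢
    refine h.imp_of_mem_imp fun b c hb hc => hrs b ?_ c ?_ <;> simp_all [or_comm]

theorem injOn_of_nodup_map {f : α → β} (h : (C.map f).Nodup) : Set.InjOn f {a | a ∈ C} := by
  induction C using Quotient.inductionOn' with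
  | h l => exact fun a ha b hb => List.inj_on_of_nodup_map h ha hb

theorem sum_filter_mem_eq [Fintype α] [DecidableEq β] {f : α → β} [DecidablePred (· ∈ C)]
    (h : (C.map f).Nodup) (b : β) [Decidable (b ∈ C.map f)] :
    ∑ a with f a = b, (if a ∈ C then 1 else 0 : ZMod 2) = if b ∈ C.map f then 1 else 0 := by
  classical
  split_ifs with hb
  · obtain ⟨a, ha, rfl⟩ := Cycle.mem_map.1 hb
    rw [Finset.sum_eq_single_of_mem a (by simp), if_pos ha]
    exact fun c hc hca => if_neg fun hcC =>
      hca (injOn_of_nodup_map h hcC ha (Finset.mem_filter.1 hc).2)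
  · refine Finset.sum_eq_zero fun a ha => if_neg fun haC => hb (Cycle.mem_map.2 ⟨a, haC, ?_⟩)
    exact (Finset.mem_filter.1 ha).2

end Cycle

namespace Multigraph

variable {G : Multigraph.{u}} {C : Cycle G.D}

theorem IsCycle.map_src_rev (h : G.IsCycle C) :
    C.map (fun d => G.src (G.rev d)) = C.map G.src :=
  map_eq_map_of_chain h.2.1

theorem IsCycle.eq_of_src_eq (h : G.IsCycle C) {d e : G.D} (hd : d ∈ C) (he : e ∈ C)
    (hde : G.src d = G.src e) : d = e :=
  injOn_of_nodup_map h.2.2.1 hd he hde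

theorem IsCycle.nodup_map_src_rev (h : G.IsCycle C) :
    (C.map fun d => G.src (G.rev d)).Nodup :=
  h.map_src_rev ▸ h.2.2.1

theorem IsCycle.eq_of_src_rev_eq (h : G.IsCycle C) {d e : G.D} (hd : d ∈ C) (he : e ∈ C)
    (hde : G.src (G.rev d) = G.src (G.rev e)) : d = e :=
  injOn_of_nodup_map h.nodup_map_src_rev hd he hde

theorem IsCycle.sum_mem_add_rev_mem (h : G.IsCycle C) [Fintype G.D] [DecidableEq G.V]
    [DecidablePred (· ∈ C)] (v : G.V) :
    ∑ d with G.src d = v,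
      ((if d ∈ C then 1 else 0) + if G.rev d ∈ C then 1 else 0 : ZMod 2) = 0 := by
  classical
  have hrev : ∑ d with G.src d = v, (if G.rev d ∈ C then 1 else 0 : ZMod 2) =
      ∑ d with G.src (G.rev d) = v, if d ∈ C then 1 else 0 :=
    Finset.sum_nbij' G.rev G.rev (by simp [G.rev_rev]) (by simp) (by simp [G.rev_rev])
      (by simp [G.rev_rev]) (by simp)
  rw [Finset.sum_add_distrib, hrev, sum_filter_mem_eq h.2.2.1,
    sum_filter_mem_eq h.nodup_map_src_rev]
  simp only [h.map_src_rev]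
  exact CharTwo.add_self_eq_zero _

end Multigraph

namespace PlaneGraph

variable {G : PlaneGraph.{u}} {C : Cycle G.D} {f g : G.Face}

theorem AdjOff.symm (h : G.AdjOff C f g) : G.AdjOff C g f := by
  obtain ⟨d, hd, hrd, hf, hg⟩ := h
  exact ⟨G.rev d, hrd, by rwa [G.rev_rev], hg, by rwa [G.rev_rev]⟩

/-- Two faces are on the same side of `C` if one can be reached from the other without crossing `C`;
thus `FaceOutside` means being on the same side as the outer face. -/
abbrev SameSide (G : PlaneGraph.{u}) (C : Cycle G.D) : G.Face → G.Face → Prop :=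
  Relation.ReflTransGen (G.AdjOff C)

theorem SameSide.symm (h : G.SameSide C f g) : G.SameSide C g f := by
  induction h with
  | refl => exact .refl
  | tail _ h ih => exact .head h.symm ih

theorem sameSide_of_off {a b : G.D} (hab : G.src a = G.src b)
    (hoff : ∀ d, G.src d = G.src a → d ≠ a → d ≠ b → d ∉ C ∧ G.rev d ∉ C) :
    G.SameSide C (G.face (G.rev a)) (G.face b) := by
  by_contra hb
  have hb' : ¬ G.SameSide C (G.face (G.rev a)) (G.face (G.rev (G.next.symm b))) := by
    rwa [← G.face_next (G.next.symm b), Equiv.apply_symm_apply]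
  obtain ⟨z, hz, hz', hza⟩ := G.exists_mem_next_notMem
    (S := {z | G.SameSide C (G.face (G.rev a)) (G.face (G.rev z))}) (x := a) .refl hb'
    (by rw [hab, ← G.src_next (G.next.symm b), Equiv.apply_symm_apply])
  rw [Set.mem_ofPred_eq, ← G.face_next z] at hz
  obtain ⟨hoff₁, hoff₂⟩ := hoff (G.next z) ((G.src_next z).trans hza)
    (fun h => hz' (h ▸ .refl)) (fun h => hb (h ▸ hz))
  exact hz' (hz.tail ⟨_, hoff₁, hoff₂, rfl, rfl⟩)

theorem sameSide_of_chain {k : G.D → G.Face}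
    (h : C.Chain fun a b => G.SameSide C (k a) (k b)) {d e : G.D} (hd : d ∈ C) (he : e ∈ C) :
    G.SameSide C (k d) (k e) :=
  Cycle.chain_iff_pairwise.1 ((Cycle.chain_map k).2 h) _ (Cycle.mem_map.2 ⟨d, hd, rfl⟩) _
    (Cycle.mem_map.2 ⟨e, he, rfl⟩)

section Jordan

variable (hC : G.IsCycle C) {d e : G.D}
include hC

theorem off_of_src_eq (hd : d ∈ C) (he : e ∈ C) (hde : G.src (G.rev d) = G.src e) {z : G.D}
    (hz : G.src z = G.src e) (hze : z ≠ e) (hzd : z ≠ G.rev d) : z ∉ C ∧ G.rev z ∉ C := by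
  refine ⟨fun h => hze (hC.eq_of_src_eq h he hz), fun h => hzd ?_⟩
  rw [← hC.eq_of_src_rev_eq h hd (by rw [G.rev_rev, hz, hde]), G.rev_rev]

theorem sameSide_left (hd : d ∈ C) (he : e ∈ C) : G.SameSide C (G.face d) (G.face e) := by
  refine sameSide_of_chain (chain_imp_of_mem hC.2.1 fun a ha b hb hab => ?_) hd he
  simpa only [G.rev_rev] using sameSide_of_off hab fun z hz hza hzb =>
    off_of_src_eq hC ha hb hab (hz.trans hab) hzb hza

theorem sameSide_right (hd : d ∈ C) (he : e ∈ C) :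
    G.SameSide C (G.face (G.rev d)) (G.face (G.rev e)) := by
  refine sameSide_of_chain (k := fun d => G.face (G.rev d))
    (chain_imp_of_mem hC.2.1 fun a ha b hb hab => ?_) hd he
  exact SameSide.symm (sameSide_of_off hab.symm fun z hz hzb hza =>
    off_of_src_eq hC ha hb hab hz hzb hza)

theorem not_sameSide_rev (hd : d ∈ C) (he : e ∈ C) :
    ¬ G.SameSide C (G.face d) (G.face (G.rev e)) := by
  classical
  have := Fintype.ofFinite G.D
  obtain ⟨p, hp⟩ := exists_facePotential (fun d => if d ∈ C then 1 else 0)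
    (fun v => hC.sum_mem_add_rev_mem v)
  have hconst : ∀ ⦃f g⦄, G.AdjOff C f g → p f = p g := by
    rintro _ _ ⟨z, hz, hrz, rfl, rfl⟩
    exact CharTwo.add_eq_zero.1 (by simp [hp, hz, hrz])
  intro hside
  have heq : p (G.face d) = p (G.face (G.rev d)) := by
    simpa only [Relation.reflTransGen_eq_self] using
      (hside.trans (sameSide_right hC he hd)).lift p hconst
  have hjump := hp d
  rw [heq, CharTwo.add_self_eq_zero, if_pos hd, if_neg (hC.2.2.2 d hd)] at hjump
  exact absurd hjump (by decide)

theorem sameSide_or_sameSide_rev (hd : d ∈ C) (he : e ∈ C) (f : G.Face) :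
    G.SameSide C f (G.face d) ∨ G.SameSide C f (G.face (G.rev e)) := by
  obtain ⟨a, rfl⟩ := G.face_surjective f
  have hrev : ∀ z, G.SameSide C (G.face z) (G.face d) ∨
      G.SameSide C (G.face z) (G.face (G.rev e)) →
      G.SameSide C (G.face (G.rev z)) (G.face d) ∨
      G.SameSide C (G.face (G.rev z)) (G.face (G.rev e)) := by
    intro z hz
    by_cases hzC : z ∈ C
    · exact Or.inr (sameSide_right hC hzC he)
    by_cases hrC : G.rev z ∈ C
    · exact Or.inl (sameSide_left hC hrC hd)
    have hadj : G.AdjOff C (G.face (G.rev z)) (G.face z) := AdjOff.symm ⟨z, hzC, hrC, rfl, rfl⟩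
    exact hz.imp (.head hadj) (.head hadj)
  refine mem_of_closed (S := {z | G.SameSide C (G.face z) (G.face d) ∨
    G.SameSide C (G.face z) (G.face (G.rev e))}) hrev (fun z hz => ?_) (x := d) (Or.inl .refl) a
  simpa only [Set.mem_ofPred_eq, G.face_next] using hrev z hz

theorem isSeparatingCycle_of_off (hd : d ∈ C) (he : e ∈ C) {d' e' : G.D}
    (hd' : d' ∉ C ∧ G.rev d' ∉ C) (hdd' : G.face d' = G.face d)
    (he' : e' ∉ C ∧ G.rev e' ∉ C) (hee' : G.face e' = G.face (G.rev e)) :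
    G.IsSeparatingCycle C := by
  have hnot := not_sameSide_rev hC hd he
  have hpart : ∀ {P : G.Face → Prop} {z : G.D}, z ∉ C ∧ G.rev z ∉ C → P (G.face z) →
      (G.partOff C P).Nonempty := fun hz hP => ⟨_, Or.inr ⟨_, rfl, hz.1, hz.2, hP⟩⟩
  refine ⟨hC, ?_⟩
  rcases sameSide_or_sameSide_rev hC hd he G.outer with hout | hout
  · refine ⟨hpart he' fun h => ?_, hpart hd' (hdd' ▸ hout)⟩
    exact hnot (hout.symm.trans (hee' ▸ h))
  · refine ⟨hpart hd' fun h => ?_, hpart he' (hee' ▸ hout)⟩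
    exact hnot (SameSide.symm (hdd' ▸ h) |>.trans hout)

end Jordan

end PlaneGraph

section Iterate

variable {α : Type*} {f : α → α} {S : Set α} {a : α}

theorem exists_first_exit {n : ℕ} (ha : a ∈ S) (hn : f^[n] a ∉ S) :
    ∃ k, (∀ i ≤ k, f^[i] a ∈ S) ∧ f^[k + 1] a ∉ S := by
  classical
  have hex : ∃ n, f^[n] a ∉ S := ⟨n, hn⟩
  obtain ⟨k, hk⟩ := Nat.exists_eq_succ_of_ne_zero
    (fun h0 => Nat.find_spec hex (by rwa [h0]) : Nat.find hex ≠ 0)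
  refine ⟨k, fun i hi => not_not.1 (Nat.find_min hex (by lia)), ?_⟩
  simpa only [hk] using Nat.find_spec hex

-- If an orbit revisited a point before leaving `S`, it would never leave `S`.
theorem injOn_iterate_of_first_exit {m : ℕ} (hmem : ∀ i < m, f^[i] a ∈ S) (hm : f^[m] a ∉ S) :
    Set.InjOn (fun i => f^[i] a) (Set.Iic m) := by
  have hlt : ∀ i j, i < j → j ≤ m → f^[i] a ≠ f^[j] a := fun i j hij hj h => by
    refine hm ?_
    rw [← Nat.sub_add_cancel hj, Function.iterate_add_apply, ← h, ← Function.iterate_add_apply]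
    exact hmem _ (by lia)
  intro i hi j hj hij
  by_contra hne
  rcases Nat.lt_or_gt_of_ne hne with h | h
  exacts [hlt i j h hj hij, hlt j i h hi hij.symm]

end Iterate

namespace Multigraph

/-- The darts of `l` form a walk from `x` to `y`. The list of visited vertices is expressed both by
the sources of the darts and by their targets. -/
def IsDartWalk (G : Multigraph.{u}) (x : G.V) (l : List G.D) (y : G.V) : Prop :=
  l.map G.src ++ [y] = x :: l.map fun d => G.src (G.rev d)

namespace IsDartWalk

variable {G : Multigraph.{u}} {x y z : G.V} {l l' : List G.D}

theorem append (h : G.IsDartWalk x l y) (h' : G.IsDartWalk y l' z) :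
    G.IsDartWalk x (l ++ l') z := by
  rw [IsDartWalk] at *
  rw [List.map_append, List.append_assoc, h', List.append_cons, h, List.map_append,
    List.cons_append]

theorem reverse (h : G.IsDartWalk x l y) : G.IsDartWalk y (l.reverse.map G.rev) x := by
  have hrev := congrArg List.reverse h
  simp only [List.reverse_append, List.reverse_cons] at hrev
  simpa [IsDartWalk, Function.comp_def, G.rev_rev, List.map_reverse] using hrev.symm

theorem ne_nil (h : G.IsDartWalk x l y) (hxy : x ≠ y) : l ≠ [] := by
  rintro rfl
  simp only [IsDartWalk, List.map_nil, List.nil_append, List.cons.injEq, and_true] at h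
  exact hxy h.symm

theorem chain (h : G.IsDartWalk x l x) :
    (l : Cycle G.D).Chain fun d e => G.src (G.rev d) = G.src e := by
  cases l with
  | nil => exact Cycle.Chain.nil _
  | cons a l =>
    rw [Cycle.chain_coe_cons, isChain_cons_append_singleton_iff]
    rw [IsDartWalk, List.map_cons, List.cons_append, List.cons.injEq] at h
    rw [← h.2, List.map_append, List.map_singleton, h.1]

end IsDartWalk

end Multigraph

namespace PlaneGraph

variable {G : PlaneGraph.{u}}

theorem isDartWalk_map_range (a : G.D) (m : ℕ) :
    G.IsDartWalk (G.src a) ((List.range m).map fun i => G.facePerm^[i] a)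
      (G.src (G.facePerm^[m] a)) := by
  induction m with
  | zero => rfl
  | succ m ih =>
    rw [List.range_succ, List.map_append]
    refine ih.append ?_
    rw [Function.iterate_succ_apply', G.src_facePerm]
    rfl

theorem face_iterate_facePerm (a : G.D) (n : ℕ) : G.face (G.facePerm^[n] a) = G.face a := by
  induction n with
  | zero => rfl
  | succ n ih => rw [Function.iterate_succ_apply', G.face_facePerm, ih]

theorem face_rev_ne (hG : G.IsTwoConnected) (hn : ∀ d, G.next d ≠ d) (d : G.D) :
    G.face (G.rev d) ≠ G.face d := fun h =>
  hn (G.rev d) <| eq_of_face_eq_of_src_eq hG (by rw [G.face_next, G.rev_rev, h]) (G.src_next _)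

/-- `S` is closed under reversal, so it is a set of edges, and it shares no vertices with the other
edges except possibly `x` and `y`. -/
structure IsTwoSep (G : PlaneGraph.{u}) (S : Set G.D) (x y : G.V) : Prop where
  rev_mem : ∀ d, G.rev d ∈ S ↔ d ∈ S
  boundary : ∀ d ∈ S, ∀ e ∉ S, G.src d = G.src e → G.src d = x ∨ G.src d = y

/-- The rotation around the source of `a` enters `S` with `a`. If `S` is closed under reversal, then
so does the face tracing along the face of `a`. -/
def Enters (G : PlaneGraph.{u}) (S : Set G.D) (a : G.D) : Prop := a ∈ S ∧ G.next.symm a ∉ S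

/-- Every dart of the face `f` in `S` has the face `g` on its other side. -/
def Borders (G : PlaneGraph.{u}) (S : Set G.D) (f g : G.Face) : Prop :=
  ∀ d ∈ S, G.face d = f → G.face (G.rev d) = g

/-- The darts of `l` belong to `S` and to the face `f` and form a path from `x` to `y`. -/
structure IsFaceArc (G : PlaneGraph.{u}) (S : Set G.D) (f : G.Face) (x y : G.V) (l : List G.D) :
    Prop where
  walk : G.IsDartWalk x l y
  mem : ∀ d ∈ l, d ∈ S
  face_eq : ∀ d ∈ l, G.face d = f
  nodup : (l.map G.src ++ [y]).Nodup

section Arcs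

variable {S : Set G.D} {x y : G.V} {f g : G.Face} {l l' : List G.D}

theorem IsTwoSep.compl (h : G.IsTwoSep S x y) : G.IsTwoSep Sᶜ x y where
  rev_mem d := not_congr (h.rev_mem d)
  boundary d hd e he hde := by
    rw [hde]
    exact h.boundary e (not_not.1 he) d hd hde.symm

theorem IsTwoSep.symm (h : G.IsTwoSep S x y) : G.IsTwoSep S y x where
  rev_mem := h.rev_mem
  boundary d hd e he hde := (h.boundary d hd e he hde).symm

-- Follow the face until it leaves `S`. It does not return to `x`, so it leaves `S` at `y`.
theorem IsTwoSep.exists_isFaceArc (hG : G.IsTwoConnected) (h : G.IsTwoSep S x y) {a : G.D}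
    (ha : G.Enters S a) (hx : G.src a = x) :
    ∃ l b, G.IsFaceArc S (G.face a) x y l ∧ G.Enters Sᶜ b ∧ G.face b = G.face a ∧
      G.src b = y := by
  have hinj : ∀ i j, G.src (G.facePerm^[i] a) = G.src (G.facePerm^[j] a) →
      G.facePerm^[i] a = G.facePerm^[j] a := fun i j =>
    eq_of_face_eq_of_src_eq hG (by rw [face_iterate_facePerm, face_iterate_facePerm])
  have hprev : G.facePerm.symm a ∉ S := mt (h.rev_mem _).1 ha.2
  have hcycle : G.facePerm.SameCycle a (G.facePerm.symm a) := ⟨-1, by rw [zpow_neg_one]; rfl⟩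
  obtain ⟨n, hn⟩ := hcycle.exists_nat_pow_eq
  rw [Equiv.Perm.coe_pow] at hn
  obtain ⟨k, hk, hexit⟩ := exists_first_exit ha.1 (hn ▸ hprev : G.facePerm^[n] a ∉ S)
  have hy : G.src (G.facePerm^[k + 1] a) = y := by
    have hsrc : G.src (G.rev (G.facePerm^[k] a)) = G.src (G.facePerm^[k + 1] a) := by
      rw [Function.iterate_succ_apply', G.src_facePerm]
    rw [← hsrc]
    refine (h.boundary _ ((h.rev_mem _).2 (hk k le_rfl)) _ hexit hsrc).resolve_left fun hkx => ?_
    exact hexit (hinj 0 (k + 1) (by rw [← hsrc, hkx]; exact hx) ▸ ha.1)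
  refine ⟨(List.range (k + 1)).map fun i => G.facePerm^[i] a, G.facePerm^[k + 1] a,
    ⟨?_, ?_, ?_, ?_⟩, ⟨hexit, ?_⟩, face_iterate_facePerm _ _, hy⟩
  · exact hx ▸ hy ▸ isDartWalk_map_range a (k + 1)
  · exact List.forall_mem_map.2 fun i hi => hk i (Nat.lt_succ_iff.1 (List.mem_range.1 hi))
  · exact List.forall_mem_map.2 fun i _ => face_iterate_facePerm a i
  · have hsnoc : ((List.range (k + 1)).map fun i => G.facePerm^[i] a).map G.src ++ [y] =
        (List.range (k + 1 + 1)).map fun i => G.src (G.facePerm^[i] a) := by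
      rw [List.range_succ (n := k + 1), List.map_append, List.map_map, List.map_singleton, hy]
      rfl
    rw [hsnoc, List.nodup_map_iff_inj_on List.nodup_range]
    intro i hi j hj hij
    rw [List.mem_range, Nat.lt_succ_iff] at hi hj
    exact injOn_iterate_of_first_exit (fun i hi => hk i (Nat.lt_succ_iff.1 hi)) hexit hi hj
      (hinj i j hij)
  · rw [Function.iterate_succ_apply', G.facePerm_apply, Equiv.symm_apply_apply]
    exact not_not.2 ((h.rev_mem _).2 (hk k le_rfl))

theorem IsFaceArc.length_le (h : G.IsFaceArc S f x y l) :
    l.length ≤ {d | G.face d = f ∧ d ∈ S}.ncard := by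
  classical
  rw [← List.toFinset_card_of_nodup h.nodup.of_append_left.of_map, ← Set.ncard_coe_finset]
  refine Set.ncard_le_ncard (fun d hd => ?_) (Set.toFinite _)
  rw [Finset.mem_coe, List.mem_toFinset] at hd
  exact ⟨h.face_eq d hd, h.mem d hd⟩

/-- The cycle that follows the path `l` and returns along the path `l'`. -/
def arcCycle (G : PlaneGraph.{u}) (l l' : List G.D) : Cycle G.D := ↑(l ++ l'.reverse.map G.rev)

theorem length_arcCycle : (G.arcCycle l l').length = l.length + l'.length := by
  simp [arcCycle]

theorem mem_arcCycle {d : G.D} : d ∈ G.arcCycle l l' ↔ d ∈ l ∨ G.rev d ∈ l' := by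
  have hrev : (∃ e ∈ l', G.rev e = d) ↔ G.rev d ∈ l' :=
    ⟨fun ⟨e, he, hed⟩ => by rwa [← hed, G.rev_rev], fun hd => ⟨_, hd, G.rev_rev d⟩⟩
  simp [arcCycle, hrev]

theorem IsFaceArc.src_ne_right (h : G.IsFaceArc S f x y l) {d : G.D} (hd : d ∈ l) :
    G.src d ≠ y := fun hdy =>
  List.disjoint_of_nodup_append h.nodup (List.mem_map_of_mem hd) (by simp [hdy])

theorem IsFaceArc.nodup_cons (h : G.IsFaceArc S f x y l) :
    (x :: l.map fun d => G.src (G.rev d)).Nodup :=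
  h.walk ▸ h.nodup

theorem IsFaceArc.src_rev_ne_left (h : G.IsFaceArc S f x y l) {d : G.D} (hd : d ∈ l) :
    G.src (G.rev d) ≠ x := fun hdx =>
  (List.nodup_cons.1 h.nodup_cons).1 (List.mem_map.2 ⟨d, hd, hdx⟩)

theorem isCycle_arcCycle (hG : G.IsTwoConnected) (hn : ∀ d, G.next d ≠ d) (hxy : x ≠ y)
    (h : G.IsTwoSep S x y) (hl : G.IsFaceArc S f x y l) (hl' : G.IsFaceArc Sᶜ g x y l') :
    G.IsCycle (G.arcCycle l l') := by
  have hdisj : List.Disjoint (l.map G.src) (l'.map fun d => G.src (G.rev d)) := by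
    rintro v hv hv'
    obtain ⟨d, hd, rfl⟩ := List.mem_map.1 hv
    obtain ⟨e, he, hed⟩ := List.mem_map.1 hv'
    rcases h.boundary d (hl.mem d hd) (G.rev e) (mt (h.rev_mem e).1 (hl'.mem e he)) hed.symm with
      hdx | hdy
    · exact hl'.src_rev_ne_left he (hed.trans hdx)
    · exact hl.src_ne_right hd hdy
  have hnodup : ((l ++ l'.reverse.map G.rev).map G.src).Nodup := by
    rw [List.map_append, List.map_map, List.map_reverse]
    exact List.nodup_append'.2 ⟨hl.nodup.of_append_left,
      List.nodup_reverse.2 (List.nodup_cons.1 hl'.nodup_cons).2,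
      fun v hv hv' => hdisj hv (List.mem_reverse.1 hv')⟩
  refine ⟨fun hnil => ?_, (hl.walk.append hl'.walk.reverse).chain, hnodup, fun d hd hrd => ?_⟩
  · exact hl.walk.ne_nil hxy (List.append_eq_nil_iff.1 ((Cycle.coe_eq_nil _).1 hnil)).1
  rw [mem_arcCycle] at hd hrd
  rw [G.rev_rev] at hrd
  rcases hd with hd | hd <;> rcases hrd with hrd | hrd
  · exact face_rev_ne hG hn d ((hl.face_eq _ hrd).trans (hl.face_eq _ hd).symm)
  · exact hl'.mem _ hrd (hl.mem _ hd)
  · exact hl'.mem _ hd (hl.mem _ hrd)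
  · exact face_rev_ne hG hn d ((hl'.face_eq _ hd).trans (hl'.face_eq _ hrd).symm)

theorem isSeparatingCycle_arcCycle (hG : G.IsTwoConnected) (hn : ∀ d, G.next d ≠ d) (hxy : x ≠ y)
    (h : G.IsTwoSep S x y) (hl : G.IsFaceArc S f x y l) (hl' : G.IsFaceArc Sᶜ g x y l')
    (hf : ¬ G.Borders Sᶜ f g) (hg : ¬ G.Borders S g f) :
    G.IsSeparatingCycle (G.arcCycle l l') := by
  have hC := isCycle_arcCycle hG hn hxy h hl hl'
  obtain ⟨d, hd⟩ := List.exists_mem_of_ne_nil l (hl.walk.ne_nil hxy)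
  obtain ⟨e, he⟩ := List.exists_mem_of_ne_nil l' (hl'.walk.ne_nil hxy)
  have hdC : d ∈ G.arcCycle l l' := mem_arcCycle.2 (Or.inl hd)
  have heC : G.rev e ∈ G.arcCycle l l' := mem_arcCycle.2 (Or.inr ((G.rev_rev e).symm ▸ he))
  have hfg : f ≠ g := fun h => not_sameSide_rev hC hdC heC <| by
    rw [G.rev_rev, hl.face_eq d hd, hl'.face_eq e he, h]
  simp only [Borders, not_forall] at hf hg
  obtain ⟨d', hd', hdf, hdg⟩ := hf
  obtain ⟨e', he', heg, hef⟩ := hg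
  refine isSeparatingCycle_of_off hC hdC heC (d' := d') (e' := e') ?_
    (hdf.trans (hl.face_eq d hd).symm) ?_
    (heg.trans (by rw [G.rev_rev, hl'.face_eq e he])) <;>
    rw [mem_arcCycle, mem_arcCycle, G.rev_rev, not_or, not_or]
  · exact ⟨⟨fun hm => hd' (hl.mem _ hm), fun hm => hdg (hl'.face_eq _ hm)⟩,
      fun hm => hd' ((h.rev_mem _).1 (hl.mem _ hm)),
      fun hm => hfg (hdf.symm.trans (hl'.face_eq _ hm))⟩
  · exact ⟨⟨fun hm => hfg ((hl.face_eq _ hm).symm.trans heg),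
      fun hm => hl'.mem _ hm ((h.rev_mem _).2 he')⟩,
      fun hm => hef (hl.face_eq _ hm), fun hm => hl'.mem _ hm he'⟩

end Arcs

end PlaneGraph

namespace PlaneGraph

variable {G : PlaneGraph.{u}}

theorem faceDegree_eq_ncard (hG : G.IsTwoConnected) (f : G.Face) :
    G.faceDegree f = {d | G.face d = f}.ncard := by
  have himage : {v | ∃ d, G.src d = v ∧ G.face d = f} = G.src '' {d | G.face d = f} := by
    ext v
    exact exists_congr fun d => and_comm
  rw [EmbeddedGraph.faceDegree, himage, Set.InjOn.ncard_image]
  exact fun d hd e he hde => eq_of_face_eq_of_src_eq hG (Eq.trans hd (Eq.symm he)) hde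

theorem faceDegree_le_maxFaceDegree (f : G.Face) : G.faceDegree f ≤ G.maxFaceDegree :=
  le_ciSup (Set.finite_range _).bddAbove f

theorem ncard_face_add_ncard_face_compl_le (hG : G.IsTwoConnected) (S : Set G.D) (f : G.Face) :
    {d | G.face d = f ∧ d ∈ S}.ncard + {d | G.face d = f ∧ d ∈ Sᶜ}.ncard ≤ G.maxFaceDegree := by
  refine le_trans (le_of_eq ?_) (faceDegree_le_maxFaceDegree f)
  rw [faceDegree_eq_ncard hG]
  exact Set.ncard_inter_add_ncard_sdiff_eq_ncard {d | G.face d = f} S (Set.toFinite _)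

/-- `G` has a separating cycle that is not longer than its largest face. -/
def HasShortSeparatingCycle (G : PlaneGraph.{u}) : Prop :=
  ∃ C : Cycle G.D, G.IsSeparatingCycle C ∧ C.length ≤ G.maxFaceDegree

section ShortCycles

variable {S : Set G.D} {x y : G.V} {d e : G.D}

-- Each of the two faces is cut into two arcs. Their four arcs form two cycles, one of which has at
-- most the average length.
theorem IsTwoSep.hasShortSeparatingCycle (hG : G.IsTwoConnected) (hn : ∀ d, G.next d ≠ d)
    (hxy : x ≠ y) (h : G.IsTwoSep S x y) (hd : G.Enters Sᶜ d) (hdx : G.src d = x)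
    (he : G.Enters S e) (hex : G.src e = x)
    (hS : ¬ G.Borders S (G.face d) (G.face e) ∧ ¬ G.Borders S (G.face e) (G.face d))
    (hSc : ¬ G.Borders Sᶜ (G.face d) (G.face e) ∧ ¬ G.Borders Sᶜ (G.face e) (G.face d)) :
    G.HasShortSeparatingCycle := by
  obtain ⟨l₁, d', hl₁, hd', hd'f, hd'y⟩ := h.compl.exists_isFaceArc hG hd hdx
  obtain ⟨k₁, e', hk₁, he', he'f, he'y⟩ := h.exists_isFaceArc hG he hex
  rw [compl_compl] at hd'
  obtain ⟨l₂, -, hl₂, -⟩ := h.symm.exists_isFaceArc hG hd' hd'y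
  obtain ⟨k₂, -, hk₂, -⟩ := h.compl.symm.exists_isFaceArc hG he' he'y
  rw [hd'f] at hl₂
  rw [he'f] at hk₂
  have hsep₁ := isSeparatingCycle_arcCycle hG hn hxy h hk₁ hl₁ hSc.2 hS.1
  have hsep₂ := isSeparatingCycle_arcCycle hG hn hxy.symm h.symm hl₂ hk₂ hSc.1 hS.2
  have hdeg_d := ncard_face_add_ncard_face_compl_le hG S (G.face d)
  have hdeg_e := ncard_face_add_ncard_face_compl_le hG S (G.face e)
  have := hl₁.length_le
  have := hl₂.length_le
  have := hk₁.length_le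
  have := hk₂.length_le
  by_cases hle : k₁.length + l₁.length ≤ G.maxFaceDegree
  · exact ⟨_, hsep₁, by rwa [length_arcCycle]⟩
  · exact ⟨_, hsep₂, by rw [length_arcCycle]; lia⟩

theorem Borders.next_eq (hG : G.IsTwoConnected) (hb : G.Borders S (G.face d) (G.face e))
    (hd : d ∈ S) (hde : G.src d = G.src e) : G.next d = e := by
  refine eq_of_face_eq_of_src_eq hG ?_ (by rw [G.src_next, hde])
  rw [G.face_next, hb d hd rfl]

theorem Borders.eq_next (hG : G.IsTwoConnected) (hb : G.Borders S (G.face d) (G.face e))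
    (h : G.IsTwoSep S x y) (hd : G.next.symm d ∈ S) (hde : G.src d = G.src e) : d = G.next e := by
  have hprev := G.src_next (G.next.symm d)
  have hface := G.face_next (G.next.symm d)
  rw [Equiv.apply_symm_apply] at hprev hface
  have hbd := hb _ ((h.rev_mem _).2 hd) hface.symm
  rw [G.rev_rev] at hbd
  rw [← Equiv.symm_apply_eq]
  exact eq_of_face_eq_of_src_eq hG hbd (hprev.symm.trans hde)

theorem IsTwoSep.hasShortSeparatingCycle_of_next_ne (hG : G.IsTwoConnected)
    (hn : ∀ d, G.next d ≠ d) (hxy : x ≠ y) (h : G.IsTwoSep S x y) (hd : G.Enters Sᶜ d)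
    (hdx : G.src d = x) (he : G.Enters S e) (hex : G.src e = x) (hde : e ≠ G.next d)
    (hed : d ≠ G.next e) : G.HasShortSeparatingCycle := by
  have hsrc : G.src d = G.src e := hdx.trans hex.symm
  refine h.hasShortSeparatingCycle hG hn hxy hd hdx he hex ⟨fun hb => ?_, fun hb => ?_⟩
    ⟨fun hb => ?_, fun hb => ?_⟩
  · exact hed (hb.eq_next hG h (not_not.1 hd.2) hsrc)
  · exact hed (hb.next_eq hG he.1 hsrc.symm).symm
  · exact hde (hb.next_eq hG hd.1 hsrc).symm
  · exact hde (hb.eq_next hG h.compl he.2 hsrc.symm)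

theorem exists_enters {a b : G.D} (ha : a ∈ S) (hb : b ∉ S) (hab : G.src a = G.src b) :
    ∃ c, G.Enters Sᶜ c ∧ G.src c = G.src a := by
  obtain ⟨z, hz, hz', hs⟩ := G.exists_mem_next_notMem ha hb hab
  exact ⟨G.next z, ⟨hz', not_not.2 (by rwa [Equiv.symm_apply_apply])⟩, by rw [G.src_next, hs]⟩

-- `H` records the side of the closed curve that runs inside the faces of `d` and `e` and crosses
-- the corners before `d`, `d'`, `e'` and `e`.
theorem exists_edge_coloring [DecidableEq G.D] {d' e' : G.D} (hf : G.face d = G.face d')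
    (hg : G.face e = G.face e') (hs : G.src d = G.src e) (hs' : G.src d' = G.src e') :
    ∃ H : G.D → ZMod 2, (∀ z, H (G.rev z) = H z) ∧ ∀ z, H z + H (G.next.symm z) =
      (Pi.single d 1 + Pi.single d' 1 + (Pi.single e 1 + Pi.single e' 1) : G.D → ZMod 2) z := by
  classical
  have := Fintype.ofFinite G.D
  obtain ⟨W₁, hW₁⟩ := G.exists_coboundary_of_face_eq hf
  obtain ⟨W₂, hW₂⟩ := G.exists_coboundary_of_face_eq hg
  obtain ⟨H, hrev, hnext⟩ := exists_cornerPotential (W := W₁ + W₂)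
    (K := Pi.single d 1 + Pi.single d' 1 + (Pi.single e 1 + Pi.single e' 1))
    (fun z => by rw [Pi.add_apply, Pi.add_apply, add_add_add_comm, hW₁, hW₂]; rfl) fun v => by
      simp [Finset.sum_add_distrib, hs, hs', CharTwo.add_self_eq_zero]
  exact ⟨H, hrev, fun z => by simpa only [Equiv.apply_symm_apply] using hnext (G.next.symm z)⟩

theorem exists_isTwoSep_of_face_eq (hxy : x ≠ y) {d' e' : G.D} (hd : G.src d = x)
    (he : G.src e = x) (hd' : G.src d' = y) (he' : G.src e' = y) (hf : G.face d = G.face d')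
    (hg : G.face e = G.face e') (hne : d ≠ e) :
    ∃ S, G.IsTwoSep S x y ∧ G.Enters S d ∧ G.Enters Sᶜ e := by
  classical
  obtain ⟨H, hrev, hprev⟩ :=
    exists_edge_coloring hf hg (hd.trans he.symm) (hd'.trans he'.symm)
  have hjump : ∀ z, H (G.next.symm z) ≠ H z → z = d ∨ z = e ∨ G.src z = y := fun z hz => by
    by_contra! hcon
    have hzd' : z ≠ d' := fun h => hcon.2.2 (h ▸ hd')
    have hze' : z ≠ e' := fun h => hcon.2.2 (h ▸ he')
    refine hz (CharTwo.add_eq_zero.1 ((add_comm _ _).trans ((hprev z).trans ?_)))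
    simp [hcon.1, hcon.2.1, hzd', hze']
  have hd_jump : H (G.next.symm d) ≠ H d := fun h => by
    have hdd' : d ≠ d' := fun h => hxy (by rw [← hd, h, hd'])
    have hde' : d ≠ e' := fun h => hxy (by rw [← hd, h, he'])
    have := hprev d
    simp [hne, hdd', hde', h, CharTwo.add_self_eq_zero] at this
  have hd_enters : G.Enters {z | H z = H d} d := ⟨rfl, hd_jump⟩
  refine ⟨{z | H z = H d}, ⟨fun z => by simp [hrev], fun a ha b hb hab => ?_⟩, hd_enters, ?_⟩
  · obtain ⟨z, hz, hza⟩ := exists_enters ha hb hab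
    rw [← hza]
    rcases hjump z fun h => hz.1 (h.symm.trans (not_not.1 hz.2)) with rfl | rfl | hzy
    exacts [Or.inl hd, Or.inl he, Or.inr hzy]
  · obtain ⟨c, hc, hcd⟩ := exists_enters hd_enters.1 hd_enters.2
      (by rw [← G.src_next (G.next.symm d), Equiv.apply_symm_apply])
    rcases hjump c fun h => hc.1 (h.symm.trans (not_not.1 hc.2)) with rfl | rfl | hcy
    exacts [absurd rfl hc.1, hc, absurd (hd.symm.trans (hcd.symm.trans hcy)) hxy]

theorem hasShortSeparatingCycle_of_face_eq (hG : G.IsTwoConnected) (hn : ∀ d, G.next d ≠ d)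
    (hxy : x ≠ y) {d' e' : G.D} (hd : G.src d = x) (he : G.src e = x) (hd' : G.src d' = y)
    (he' : G.src e' = y) (hf : G.face d = G.face d') (hg : G.face e = G.face e') (hne : d ≠ e)
    (hde : e ≠ G.next d) (hed : d ≠ G.next e) : G.HasShortSeparatingCycle := by
  obtain ⟨S, hS, hdS, heS⟩ := exists_isTwoSep_of_face_eq hxy hd he hd' he' hf hg hne
  exact hS.hasShortSeparatingCycle_of_next_ne hG hn hxy heS he hdS hd hed hde

end ShortCycles

section SectorPairs

variable {S : Set G.D} {x y : G.V} {d e : G.D} {f g : G.Face}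

/-- The darts of `S` at `x` form a single interval of the rotation, which starts with `e`, and the
other darts at `x` form an interval which starts with `d`. -/
structure IsSectorPair (G : PlaneGraph.{u}) (S : Set G.D) (x : G.V) (d e : G.D) : Prop where
  src_left : G.src d = x
  src_right : G.src e = x
  enters_compl : G.Enters Sᶜ d
  enters : G.Enters S e
  eq_left : ∀ c, G.src c = x → G.Enters Sᶜ c → c = d
  eq_right : ∀ c, G.src c = x → G.Enters S c → c = e

theorem IsSectorPair.compl (h : G.IsSectorPair S x d e) : G.IsSectorPair Sᶜ x e d where
  src_left := h.src_right
  src_right := h.src_left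
  enters_compl := by rw [compl_compl]; exact h.enters
  enters := h.enters_compl
  eq_left := by rw [compl_compl]; exact h.eq_right
  eq_right := h.eq_left

-- The faces of `d` and `e` run through `Sᶜ` and `S` from `x` to `y`.
theorem IsSectorPair.exists_opposite (hG : G.IsTwoConnected) (h : G.IsTwoSep S x y)
    (hp : G.IsSectorPair S x d e) :
    ∃ d' e', G.IsSectorPair S y e' d' ∧ G.face d' = G.face d ∧ G.face e' = G.face e := by
  obtain ⟨-, d', -, hd', hd'f, hd'y⟩ := h.compl.exists_isFaceArc hG hp.enters_compl hp.src_left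
  obtain ⟨-, e', -, he', he'f, he'y⟩ := h.exists_isFaceArc hG hp.enters hp.src_right
  rw [compl_compl] at hd'
  refine ⟨d', e', ⟨he'y, hd'y, he', hd', fun c hcy hc => ?_, fun c hcy hc => ?_⟩, hd'f, he'f⟩
  · obtain ⟨-, b, -, hb, hbf, hbx⟩ := h.compl.symm.exists_isFaceArc hG hc hcy
    rw [compl_compl] at hb
    refine eq_of_face_eq_of_src_eq hG ?_ (hcy.trans he'y.symm)
    rw [he'f, ← hp.eq_right b hbx hb, hbf]
  · obtain ⟨-, b, -, hb, hbf, hbx⟩ := h.symm.exists_isFaceArc hG hc hcy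
    refine eq_of_face_eq_of_src_eq hG ?_ (hcy.trans hd'y.symm)
    rw [hd'f, ← hp.eq_left b hbx hb, hbf]

theorem IsSectorPair.eq_of_next_eq (hp : G.IsSectorPair S x d e) (hed : G.next e = d) {z : G.D}
    (hz : z ∈ S) (hzx : G.src z = x) : z = e := by
  by_contra hne
  obtain ⟨t, ht, ht', hte⟩ := G.exists_mem_next_notMem (S := {w | w ∈ S ∧ w ≠ e}ᶜ) (x := e)
    (y := z) (fun h => h.2 rfl) (fun h => h ⟨hz, hne⟩) (hp.src_right.trans hzx.symm)
  obtain ⟨hnS, hne⟩ := not_not.1 ht'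
  have hnext : G.src (G.next t) = x := by rw [G.src_next, hte, hp.src_right]
  refine hne (hp.eq_right _ hnext ⟨hnS, ?_⟩)
  rw [Equiv.symm_apply_apply]
  refine fun htS => ht ⟨htS, fun hte => hp.enters_compl.1 ?_⟩
  rwa [← hed, ← hte]

theorem IsTwoSep.mem_iff (h : G.IsTwoSep S x y) {z w : G.D} (hx : G.src z ≠ x)
    (hy : G.src z ≠ y) (hzw : G.src w = G.src z) : w ∈ S ↔ z ∈ S := by
  have hboundary : ∀ a ∈ S, ∀ b ∉ S, G.src a = G.src b → G.src a ≠ G.src z :=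
    fun a ha b hb hab haz => (h.boundary a ha b hb hab).elim
      (fun hax => hx (haz ▸ hax)) fun hay => hy (haz ▸ hay)
  exact ⟨fun hw => by_contra fun hz => hboundary w hw z hz hzw hzw,
    fun hz => by_contra fun hw => hboundary z hz w hw hzw.symm rfl⟩

-- An inner vertex of the arc `f ∩ S` has degree two: there `z` and `next z` both separate `f`
-- from `g`.
theorem Borders.face_next (hG : G.IsTwoConnected) (hb : G.Borders S f g) (h : G.IsTwoSep S x y)
    {z : G.D} (hz : z ∈ S) (hx : G.src z ≠ x) (hy : G.src z ≠ y)
    (hzf : G.face z = f ∨ G.face (G.rev z) = f) :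
    G.face (G.next z) = f ∨ G.face (G.rev (G.next z)) = f := by
  rcases hzf with hzf | hzf
  · right
    have hprev := G.src_next (G.next.symm z)
    have hface := G.face_next (G.next.symm z)
    rw [Equiv.apply_symm_apply] at hprev hface
    have hprev_mem : G.next.symm z ∈ S := (h.mem_iff hx hy hprev.symm).2 hz
    have hg := hb _ ((h.rev_mem _).2 hprev_mem) (hface.symm.trans hzf)
    rw [G.rev_rev] at hg
    have heq : G.next z = G.next.symm z := by
      refine eq_of_face_eq_of_src_eq hG ?_ (by rw [G.src_next, hprev])
      rw [G.face_next, hb z hz hzf, hg]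
    rw [heq, ← hface, hzf]
  · exact Or.inl (by rw [G.face_next, hzf])

theorem Borders.face_eq_or (hG : G.IsTwoConnected) (hb : G.Borders S f g) (h : G.IsTwoSep S x y)
    (hSc : Sᶜ.Nonempty)
    (hend : ∀ z ∈ S, G.src z = x ∨ G.src z = y → G.face z = f ∨ G.face (G.rev z) = f)
    {z : G.D} (hz : z ∈ S) : G.face z = f ∨ G.face (G.rev z) = f := by
  by_contra hzf
  obtain ⟨c, hc⟩ := hSc
  refine hc (Multigraph.mem_of_connected G.connected
    (S := {w | w ∈ S ∧ ¬ (G.face w = f ∨ G.face (G.rev w) = f)}) ?_ ?_ ⟨hz, hzf⟩ c).1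
  · rintro w ⟨hw, hwf⟩
    exact ⟨(h.rev_mem w).2 hw, by rwa [G.rev_rev, or_comm]⟩
  · rintro w ⟨hw, hwf⟩ t hwt
    have hwx : G.src w ≠ x := fun hwx => hwf (hend w hw (Or.inl hwx))
    have hwy : G.src w ≠ y := fun hwy => hwf (hend w hw (Or.inr hwy))
    refine ⟨(h.mem_iff hwx hwy hwt.symm).2 hw, fun htf => ?_⟩
    obtain ⟨s, hs, hs', hst⟩ := G.exists_mem_next_notMem
      (S := {w | G.face w = f ∨ G.face (G.rev w) = f}) htf hwf hwt.symm
    have hsw := hst.trans hwt.symm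
    exact hs' (hb.face_next hG h ((h.mem_iff hwx hwy hsw).2 hw) (hsw ▸ hwx) (hsw ▸ hwy) hs)

theorem IsSectorPair.face_eq_or (hG : G.IsTwoConnected) (h : G.IsTwoSep S x y)
    (hp : G.IsSectorPair S x d e) (hb : G.Borders S (G.face d) (G.face e))
    (hed : G.next e = d) {z : G.D} (hz : z ∈ S) :
    G.face z = G.face d ∨ G.face (G.rev z) = G.face d := by
  obtain ⟨d', e', hp', hd', he'⟩ := hp.exists_opposite hG h
  rw [← hd', ← he'] at hb
  have hde' : G.next d' = e' :=
    hb.next_eq hG hp'.enters.1 (hp'.src_right.trans hp'.src_left.symm)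
  rw [← hd']
  refine hb.face_eq_or hG h ⟨d, hp.enters_compl.1⟩ (fun z hz hzxy => ?_) hz
  rcases hzxy with hzx | hzy
  · rw [hp.eq_of_next_eq hed hz hzx, ← G.face_next, hed, hd']
    exact Or.inr rfl
  · rw [hp'.eq_of_next_eq hde' hz hzy]
    exact Or.inl rfl

-- All edges of `S` lie on the arc of the face of `d` in `S`, so `S` is a path.
theorem IsSectorPair.ncard_lt (hG : G.IsTwoConnected) (h : G.IsTwoSep S x y)
    (hp : G.IsSectorPair S x d e) (hb : G.Borders S (G.face d) (G.face e)) :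
    S.ncard < 2 * (G.src '' S).ncard := by
  have hsrc : G.src d = G.src e := hp.src_left.trans hp.src_right.symm
  have hed : G.next e = d := (hb.eq_next hG h (not_not.1 hp.enters_compl.2) hsrc).symm
  set X : Set G.D := {z | z ∈ S ∧ G.face z = G.face d}
  have hXcard : X.ncard + 1 ≤ (G.src '' S).ncard := by
    have hinj : Set.InjOn G.src X := fun z hz w hw =>
      eq_of_face_eq_of_src_eq hG (hz.2.trans hw.2.symm)
    have hxX : x ∉ G.src '' X := by
      rintro ⟨z, hz, hzx⟩
      rw [hp.eq_of_next_eq hed hz.1 hzx] at hz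
      exact hp.enters_compl.1 (eq_of_face_eq_of_src_eq hG hz.2 hsrc.symm ▸ hz.1)
    rw [← hinj.ncard_image, ← Set.ncard_insert_of_notMem hxX]
    exact Set.ncard_le_ncard (Set.insert_subset ⟨e, hp.enters.1, hp.src_right⟩
      (Set.image_mono fun z hz => hz.1))
  have hScard : S.ncard ≤ X.ncard + X.ncard := by
    calc S.ncard ≤ (X ∪ G.rev '' X).ncard := Set.ncard_le_ncard fun z hz =>
          (hp.face_eq_or hG h hb hed hz).imp (⟨hz, ·⟩)
            fun hzf => ⟨_, ⟨(h.rev_mem z).2 hz, hzf⟩, G.rev_rev z⟩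
      _ ≤ X.ncard + (G.rev '' X).ncard := Set.ncard_union_le _ _
      _ ≤ X.ncard + X.ncard := Nat.add_le_add_left Set.ncard_image_le _
  lia

theorem IsSectorPair.not_borders (hG : G.IsTwoConnected) (h : G.IsTwoSep S x y)
    (hp : G.IsSectorPair S x d e) (hS : 2 * (G.src '' S).ncard ≤ S.ncard) :
    ¬ G.Borders S (G.face d) (G.face e) ∧ ¬ G.Borders S (G.face e) (G.face d) := by
  obtain ⟨d', e', hp', hd', he'⟩ := hp.exists_opposite hG h
  refine ⟨fun hb => (hp.ncard_lt hG h hb).not_ge hS, fun hb => ?_⟩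
  rw [← hd', ← he'] at hb
  exact (hp'.ncard_lt hG h.symm hb).not_ge hS

theorem IsTwoSep.ne (hG : G.IsTwoConnected) (h : G.IsTwoSep S x y) (hS : S.Nonempty)
    (hSc : Sᶜ.Nonempty) : x ≠ y := by
  rintro rfl
  obtain ⟨p, hp⟩ := hS
  obtain ⟨q, hq⟩ := hSc
  exact hq (Multigraph.mem_of_isTwoConnected hG x (fun d => (h.rev_mem d).2)
    (fun a ha b hab hax => by_contra fun hb => hax ((or_self_iff).1 (h.boundary a ha b hb hab)))
    hp q)

theorem IsTwoSep.exists_mem_src_eq (hG : G.IsTwoConnected) (h : G.IsTwoSep S x y)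
    (hS : S.Nonempty) (hSc : Sᶜ.Nonempty) : ∃ a ∈ S, ∃ b ∉ S, G.src a = x ∧ G.src b = x := by
  by_contra! hcon
  obtain ⟨p, hp⟩ := hS
  obtain ⟨q, hq⟩ := hSc
  refine hq (Multigraph.mem_of_isTwoConnected hG y (fun d => (h.rev_mem d).2)
    (fun a ha b hab hay => by_contra fun hb => ?_) hp q)
  have hax := (h.boundary a ha b hb hab).resolve_right hay
  exact hcon a ha b hb hax (hab ▸ hax)

theorem IsTwoSep.eq_of_enters (hG : G.IsTwoConnected) (hn : ∀ d, G.next d ≠ d) (hxy : x ≠ y)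
    (hno : ¬ G.HasShortSeparatingCycle) (h : G.IsTwoSep S x y) (hd : G.Enters S d)
    (hdx : G.src d = x) (he : G.Enters S e) (hex : G.src e = x) : d = e := by
  by_contra hne
  obtain ⟨-, d', -, -, hd', hdy⟩ := h.exists_isFaceArc hG hd hdx
  obtain ⟨-, e', -, -, he', hey⟩ := h.exists_isFaceArc hG he hex
  refine hno (hasShortSeparatingCycle_of_face_eq hG hn hxy hdx hex hdy hey hd'.symm he'.symm hne
    (fun hed => he.2 ?_) fun hde => hd.2 ?_)
  · rw [hed, Equiv.symm_apply_apply]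
    exact hd.1
  · rw [hde, Equiv.symm_apply_apply]
    exact he.1

theorem IsTwoSep.exists_isSectorPair (hG : G.IsTwoConnected) (hn : ∀ d, G.next d ≠ d)
    (hno : ¬ G.HasShortSeparatingCycle) (h : G.IsTwoSep S x y) (hS : S.Nonempty)
    (hSc : Sᶜ.Nonempty) : ∃ d e, G.IsSectorPair S x d e := by
  have hxy := h.ne hG hS hSc
  obtain ⟨a, ha, b, hb, hax, hbx⟩ := h.exists_mem_src_eq hG hS hSc
  obtain ⟨d, hd, hda⟩ := exists_enters ha hb (hax.trans hbx.symm)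
  obtain ⟨e, he, heb⟩ := exists_enters (S := Sᶜ) hb (not_not.2 ha) (hbx.trans hax.symm)
  rw [compl_compl] at he
  have hdx := hda.trans hax
  have hex := heb.trans hbx
  exact ⟨d, e, hdx, hex, hd, he,
    fun c hcx hc => h.compl.eq_of_enters hG hn hxy hno hc hcx hd hdx,
    fun c hcx hc => h.eq_of_enters hG hn hxy hno hc hcx he hex⟩

/-- A partition of the edges into two parts that share at most two vertices and are not paths (each
has at least as many edges as vertices). -/
def IsDegenerate (G : PlaneGraph.{u}) : Prop :=
  ∃ (S : Set G.D) (x y : G.V), G.IsTwoSep S x y ∧ S.Nonempty ∧ Sᶜ.Nonempty ∧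
    2 * (G.src '' S).ncard ≤ S.ncard ∧ 2 * (G.src '' Sᶜ).ncard ≤ Sᶜ.ncard

theorem IsDegenerate.hasShortSeparatingCycle (hG : G.IsTwoConnected) (hn : ∀ d, G.next d ≠ d)
    (hdeg : G.IsDegenerate) : G.HasShortSeparatingCycle := by
  obtain ⟨S, x, y, h, hS, hSc, hcard, hcard'⟩ := hdeg
  by_contra hno
  obtain ⟨d, e, hp⟩ := h.exists_isSectorPair hG hn hno hS hSc
  exact hno <| h.hasShortSeparatingCycle hG hn (h.ne hG hS hSc) hp.enters_compl hp.src_left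
    hp.enters hp.src_right (hp.not_borders hG h hcard)
    (hp.compl.not_borders hG h.compl hcard').symm

end SectorPairs

end PlaneGraph

namespace PlaneGraph

/-- The data witnessing that `H` arises from `G` by subdividing the edge of `dart`; the rotations
and the outer face are left out. The values of `dartEquiv` at `Sum.inl` are the old darts, those at
`Sum.inr` the two darts leaving the new vertex `vertexEquiv none`. -/
structure EdgeSubdivision (G H : PlaneGraph.{u}) where
  vertexEquiv : Option G.V ≃ H.V
  dartEquiv : G.D ⊕ Bool ≃ H.D
  dart : G.D
  src_inl : ∀ z, H.src (dartEquiv (Sum.inl z)) = vertexEquiv (some (G.src z))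
  src_inr : ∀ b, H.src (dartEquiv (Sum.inr b)) = vertexEquiv none
  rev_dart : H.rev (dartEquiv (Sum.inl dart)) = dartEquiv (Sum.inr false)
  rev_rev_dart : H.rev (dartEquiv (Sum.inl (G.rev dart))) = dartEquiv (Sum.inr true)
  rev_inl : ∀ z, z ≠ dart → z ≠ G.rev dart →
    H.rev (dartEquiv (Sum.inl z)) = dartEquiv (Sum.inl (G.rev z))

theorem IsEdgeSubdivision.nonempty_edgeSubdivision {G H : PlaneGraph.{u}}
    (h : G.IsEdgeSubdivision H) : Nonempty (EdgeSubdivision G H) := by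
  obtain ⟨fV, fD, d, hsrc, hsrcA, hsrcB, hrevA, hrevB, hrev, -, -⟩ := h
  exact ⟨⟨fV, fD, d, hsrc, Bool.forall_bool.2 ⟨hsrcA, hsrcB⟩, hrevA, hrevB, hrev⟩⟩

namespace EdgeSubdivision

variable {G H : PlaneGraph.{u}} (s : EdgeSubdivision G H) {S : Set G.D}

/-- The map on darts undoing the subdivision: both darts leaving the new vertex are sent to the
subdivided dart, so that the two halves of the subdivided edge are sent to that edge. -/
def contract (z : H.D) : G.D := (s.dartEquiv.symm z).elim id fun _ => s.dart

theorem contract_inl (z : G.D) : s.contract (s.dartEquiv (Sum.inl z)) = z := by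
  simp [contract]

theorem contract_inr (b : Bool) : s.contract (s.dartEquiv (Sum.inr b)) = s.dart := by
  simp [contract]

theorem rev_inr_false : H.rev (s.dartEquiv (Sum.inr false)) = s.dartEquiv (Sum.inl s.dart) := by
  rw [← s.rev_dart, H.rev_rev]

theorem rev_inr_true :
    H.rev (s.dartEquiv (Sum.inr true)) = s.dartEquiv (Sum.inl (G.rev s.dart)) := by
  rw [← s.rev_rev_dart, H.rev_rev]

theorem contract_rev (z : H.D) :
    s.contract (H.rev z) = s.contract z ∨ s.contract (H.rev z) = G.rev (s.contract z) := by
  obtain ⟨z | b, rfl⟩ := s.dartEquiv.surjective z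
  · by_cases hz : z = s.dart
    · left
      rw [hz, s.rev_dart, contract_inr, contract_inl]
    right
    by_cases hz' : z = G.rev s.dart
    · rw [hz', s.rev_rev_dart, contract_inr, contract_inl, G.rev_rev]
    · rw [s.rev_inl z hz hz', contract_inl, contract_inl]
  · cases b
    · left
      rw [rev_inr_false, contract_inr, contract_inl]
    · right
      rw [rev_inr_true, contract_inr, contract_inl]

theorem isTwoSep_preimage {x y : G.V} (h : G.IsTwoSep S x y) :
    H.IsTwoSep (s.contract ⁻¹' S) (s.vertexEquiv (some x)) (s.vertexEquiv (some y)) where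
  rev_mem z := by
    rcases s.contract_rev z with hz | hz
    · rw [Set.mem_preimage, Set.mem_preimage, hz]
    · rw [Set.mem_preimage, Set.mem_preimage, hz, h.rev_mem]
  boundary z hz t ht hzt := by
    obtain ⟨z | b, rfl⟩ := s.dartEquiv.surjective z <;>
      obtain ⟨t | c, rfl⟩ := s.dartEquiv.surjective t <;>
      simp only [Set.mem_preimage, contract_inl, contract_inr, src_inl, src_inr,
        EmbeddingLike.apply_eq_iff_eq, Option.some_inj, reduceCtorEq] at hz ht hzt ⊢
    · exact h.boundary z hz t ht hzt
    · exact absurd hz ht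

theorem dartEquiv_inl_injective : Function.Injective fun z => s.dartEquiv (Sum.inl z) :=
  s.dartEquiv.injective.comp Sum.inl_injective

theorem ncard_le_ncard_preimage : S.ncard ≤ (s.contract ⁻¹' S).ncard := by
  rw [← Set.ncard_image_of_injective S s.dartEquiv_inl_injective]
  refine Set.ncard_le_ncard (Set.image_subset_iff.2 fun z hz => ?_) (Set.toFinite _)
  simpa only [Set.mem_preimage, contract_inl] using hz

theorem ncard_add_two_le_ncard_preimage (hS : s.dart ∈ S) :
    S.ncard + 2 ≤ (s.contract ⁻¹' S).ncard := by
  have hdisj : Disjoint ((fun z => s.dartEquiv (Sum.inl z)) '' S)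
      (Set.range (s.dartEquiv ∘ Sum.inr)) := by
    rw [Set.disjoint_left]
    rintro _ ⟨z, -, rfl⟩ ⟨b, hb⟩
    exact Sum.inr_ne_inl (s.dartEquiv.injective hb)
  calc S.ncard + 2
      = ((fun z => s.dartEquiv (Sum.inl z)) '' S ∪
          Set.range (s.dartEquiv ∘ Sum.inr)).ncard := by
        rw [Set.ncard_union_eq hdisj (Set.toFinite _) (Set.toFinite _),
          Set.ncard_image_of_injective S s.dartEquiv_inl_injective, ← Set.image_univ,
          Set.ncard_image_of_injective _ (s.dartEquiv.injective.comp Sum.inr_injective),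
          Set.ncard_univ, Nat.card_eq_fintype_card, Fintype.card_bool]
    _ ≤ _ := by
        refine Set.ncard_le_ncard (Set.union_subset ?_ ?_) (Set.toFinite _)
        · rintro _ ⟨z, hz, rfl⟩
          simpa only [Set.mem_preimage, contract_inl] using hz
        · rintro _ ⟨b, rfl⟩
          simpa only [Set.mem_preimage, Function.comp_apply, contract_inr] using hS

theorem ncard_image_some (A : Set G.V) :
    ((fun v => s.vertexEquiv (some v)) '' A).ncard = A.ncard :=
  Set.ncard_image_of_injective A (s.vertexEquiv.injective.comp (Option.some_injective _))

theorem ncard_src_preimage_le : (H.src '' (s.contract ⁻¹' S)).ncard ≤ (G.src '' S).ncard + 1 := by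
  rw [← s.ncard_image_some]
  refine (Set.ncard_le_ncard ?_ (Set.toFinite _)).trans
    (Set.ncard_insert_le (s.vertexEquiv none) _)
  rintro _ ⟨z, hz, rfl⟩
  obtain ⟨z | b, rfl⟩ := s.dartEquiv.surjective z
  · rw [Set.mem_preimage, contract_inl] at hz
    exact Or.inr ⟨G.src z, ⟨z, hz, rfl⟩, (s.src_inl z).symm⟩
  · exact Or.inl (s.src_inr b)

theorem ncard_src_preimage_le_of_notMem (hS : s.dart ∉ S) :
    (H.src '' (s.contract ⁻¹' S)).ncard ≤ (G.src '' S).ncard := by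
  rw [← s.ncard_image_some]
  refine Set.ncard_le_ncard ?_ (Set.toFinite _)
  rintro _ ⟨z, hz, rfl⟩
  obtain ⟨z | b, rfl⟩ := s.dartEquiv.surjective z
  · rw [Set.mem_preimage, contract_inl] at hz
    exact ⟨G.src z, ⟨z, hz, rfl⟩, (s.src_inl z).symm⟩
  · rw [Set.mem_preimage, contract_inr] at hz
    exact absurd hz hS

theorem two_mul_ncard_src_preimage_le (hS : 2 * (G.src '' S).ncard ≤ S.ncard) :
    2 * (H.src '' (s.contract ⁻¹' S)).ncard ≤ (s.contract ⁻¹' S).ncard := by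
  by_cases hd : s.dart ∈ S
  · linarith [s.ncard_add_two_le_ncard_preimage hd, s.ncard_src_preimage_le (S := S)]
  · linarith [s.ncard_le_ncard_preimage (S := S), s.ncard_src_preimage_le_of_notMem hd]

end EdgeSubdivision

variable {G H : PlaneGraph.{u}}

theorem IsEdgeSubdivision.isDegenerate (h : G.IsEdgeSubdivision H) (hdeg : G.IsDegenerate) :
    H.IsDegenerate := by
  obtain ⟨s⟩ := h.nonempty_edgeSubdivision
  obtain ⟨S, x, y, hsep, hS, hSc, hcard, hcard'⟩ := hdeg
  have hsurj : Function.Surjective s.contract := fun z => ⟨_, s.contract_inl z⟩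
  exact ⟨s.contract ⁻¹' S, _, _, s.isTwoSep_preimage hsep, hS.preimage hsurj,
    hSc.preimage hsurj, s.two_mul_ncard_src_preimage_le hcard,
    s.two_mul_ncard_src_preimage_le hcard'⟩

theorem two_mul_card_add_two_mul_card_face (G : PlaneGraph.{u}) :
    2 * Nat.card G.V + 2 * Nat.card G.Face = Nat.card G.D + 4 := by
  linarith [G.card_darts, G.euler]

theorem IsEdgeSubdivision.card_dart (h : G.IsEdgeSubdivision H) :
    Nat.card H.D = Nat.card G.D + 2 := by
  obtain ⟨-, fD, -⟩ := h
  rw [← Nat.card_congr fD, Nat.card_sum, Nat.card_eq_fintype_card (α := Bool), Fintype.card_bool]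

theorem IsEdgeSubdivision.card_vertex (h : G.IsEdgeSubdivision H) :
    Nat.card H.V = Nat.card G.V + 1 := by
  obtain ⟨fV, -⟩ := h
  rw [← Nat.card_congr fV, Finite.card_option]

theorem IsEdgeSubdivision.card_face (h : G.IsEdgeSubdivision H) :
    Nat.card H.Face = Nat.card G.Face := by
  linarith [h.card_dart, h.card_vertex, G.two_mul_card_add_two_mul_card_face,
    H.two_mul_card_add_two_mul_card_face]

section Parallel

variable {d e : G.D}

theorem ncard_parallel (hne : d ≠ e) (hs : G.src d = G.src e) :
    ({d, e, G.rev d, G.rev e} : Set G.D).ncard = 4 := by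
  have hde : d ≠ G.rev e := by
    rintro rfl
    exact G.loopless e hs
  have hed : e ≠ G.rev d := by
    rintro rfl
    exact G.loopless d hs.symm
  have hrev : G.rev d ≠ G.rev e := G.rev_injective.ne hne
  rw [Set.ncard_insert_of_notMem (by simp [hne, (G.rev_ne d).symm, hde]) (Set.toFinite _),
    Set.ncard_insert_of_notMem (by simp [hed, (G.rev_ne e).symm]) (Set.toFinite _),
    Set.ncard_pair hrev]

theorem src_mem_of_parallel (hs : G.src d = G.src e)
    (ht : G.src (G.rev d) = G.src (G.rev e)) :
    ∀ z ∈ ({d, e, G.rev d, G.rev e} : Set G.D), G.src z = G.src d ∨ G.src z = G.src (G.rev d) := by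
  rintro z (rfl | rfl | rfl | rfl)
  exacts [Or.inl rfl, Or.inl hs.symm, Or.inr rfl, Or.inr ht.symm]

theorem isTwoSep_parallel (hs : G.src d = G.src e)
    (ht : G.src (G.rev d) = G.src (G.rev e)) :
    G.IsTwoSep {d, e, G.rev d, G.rev e} (G.src d) (G.src (G.rev d)) where
  rev_mem z := by
    have hr : ∀ z ∈ ({d, e, G.rev d, G.rev e} : Set G.D), G.rev z ∈
        ({d, e, G.rev d, G.rev e} : Set G.D) := by
      rintro z (rfl | rfl | rfl | rfl) <;> simp [G.rev_rev]
    exact ⟨fun hz => G.rev_rev z ▸ hr _ hz, hr z⟩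
  boundary z hz _ _ _ := src_mem_of_parallel hs ht z hz

-- By Euler's formula, four faces leave at least `2 |V|` darts outside a pair of parallel edges.
theorem isDegenerate_of_parallel (hF : 4 ≤ Nat.card G.Face) (hne : d ≠ e)
    (hs : G.src d = G.src e) (ht : G.src (G.rev d) = G.src (G.rev e)) : G.IsDegenerate := by
  set S : Set G.D := {d, e, G.rev d, G.rev e}
  have hcardS : S.ncard = 4 := ncard_parallel hne hs
  have hcompl := Set.ncard_add_ncard_compl S
  have hEuler := G.two_mul_card_add_two_mul_card_face
  have hsrcSc : (G.src '' Sᶜ).ncard ≤ Nat.card G.V := Set.ncard_le_card _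
  have hV : 0 < Nat.card G.V := Nat.card_pos_iff.2 ⟨⟨G.src d⟩, inferInstance⟩
  have hsrcS : (G.src '' S).ncard ≤ 2 := by
    refine (Set.ncard_le_ncard (t := {G.src d, G.src (G.rev d)}) ?_ (Set.toFinite _)).trans
      ((Set.ncard_insert_le _ _).trans (by rw [Set.ncard_singleton]))
    rintro _ ⟨z, hz, rfl⟩
    exact src_mem_of_parallel hs ht z hz
  exact ⟨S, G.src d, G.src (G.rev d), isTwoSep_parallel hs ht, ⟨d, Or.inl rfl⟩,
    Set.nonempty_of_ncard_ne_zero (by lia), by lia, by lia⟩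

end Parallel

end PlaneGraph

theorem reachable_map_of_adj {V W : Type*} {G : SimpleGraph V} {H : SimpleGraph W} {f : V → W}
    (hf : ∀ v w, G.Adj v w → H.Reachable (f v) (f w)) {v w : V} (h : G.Reachable v w) :
    H.Reachable (f v) (f w) := by
  rw [SimpleGraph.reachable_iff_reflTransGen] at h
  induction h with
  | refl => rfl
  | tail _ hadj ih => exact ih.trans (hf _ _ hadj)

namespace EmbeddedGraph

theorem apply_eq_of_face_eq (G : EmbeddedGraph.{u}) {α : Type*} {f : G.D → α}
    (hf : ∀ d, f (G.facePerm d) = f d) {d e : G.D} (h : G.face d = G.face e) : f d = f e := by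
  obtain ⟨n, rfl⟩ := ((G.face_eq_iff d e).1 h).exists_nat_pow_eq
  clear h
  induction n with
  | zero => rfl
  | succ n ih => rw [ih, pow_succ', Equiv.Perm.mul_apply, hf]

theorem src_rev_next_ne (H : EmbeddedGraph.{u}) (e : H.D) :
    H.src (H.rev (H.next e)) ≠ H.src e :=
  (H.loopless _).trans_eq (H.src_next e)

/-- The dart `e` leaves a vertex of degree two with two different neighbours; this is the situation
in which the source of `e` can be suppressed, undoing a subdivision. -/
structure IsSuppressible (H : EmbeddedGraph.{u}) (e : H.D) : Prop where
  next_next : H.next (H.next e) = e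
  next_ne : H.next e ≠ e
  src_ne : H.src (H.rev e) ≠ H.src (H.rev (H.next e))

variable {H : EmbeddedGraph.{u}} {e : H.D}

theorem IsSuppressible.eq_or_eq (h : H.IsSuppressible e) {d : H.D} (hd : H.src d = H.src e) :
    d = e ∨ d = H.next e := by
  by_contra hcon
  obtain ⟨z, hz | hz, hz', -⟩ := H.exists_mem_next_notMem (S := {e, H.next e}) (x := e) (y := d)
    (Or.inl rfl) hcon hd.symm
  · exact hz' (Or.inr (congrArg H.next hz))
  · exact hz' (Or.inl ((congrArg H.next hz).trans h.next_next))

open Classical in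
/-- Reversal of darts once the source of `e`, a vertex of degree two, is suppressed: the two edges
at this vertex are merged into one. -/
noncomputable def suppressRev (H : EmbeddedGraph.{u}) (e d : H.D) : H.D :=
  if H.rev d = e then H.rev (H.next e) else if H.rev d = H.next e then H.rev e else H.rev d

theorem suppressRev_of_eq {d : H.D} (hd : H.rev d = e) :
    H.suppressRev e d = H.rev (H.next e) := if_pos hd

theorem suppressRev_of_ne {d : H.D} (h1 : H.rev d ≠ e) (h2 : H.rev d ≠ H.next e) :
    H.suppressRev e d = H.rev d := by
  rw [suppressRev, if_neg h1, if_neg h2]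

theorem suppressRev_of_src_ne {d : H.D} (hd : H.src (H.rev d) ≠ H.src e) :
    H.suppressRev e d = H.rev d :=
  suppressRev_of_ne (fun h => hd (congrArg H.src h))
    fun h => hd ((congrArg H.src h).trans (H.src_next e))

namespace IsSuppressible

theorem suppressRev_of_eq_next (h : H.IsSuppressible e) {d : H.D} (hd : H.rev d = H.next e) :
    H.suppressRev e d = H.rev e := by
  rw [suppressRev, if_neg (hd.trans_ne h.next_ne), if_pos hd]

theorem src_suppressRev_ne (h : H.IsSuppressible e) (d : H.D) :
    H.src (H.suppressRev e d) ≠ H.src e := by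
  by_cases h1 : H.rev d = e
  · rw [suppressRev_of_eq h1]
    exact H.src_rev_next_ne e
  by_cases h2 : H.rev d = H.next e
  · rw [h.suppressRev_of_eq_next h2]
    exact H.loopless e
  rw [suppressRev_of_ne h1 h2]
  exact fun hd => (h.eq_or_eq hd).elim h1 h2

theorem suppressRev_suppressRev (h : H.IsSuppressible e) {d : H.D} (hd : H.src d ≠ H.src e) :
    H.suppressRev e (H.suppressRev e d) = d := by
  by_cases h1 : H.rev d = e
  · rw [suppressRev_of_eq h1, h.suppressRev_of_eq_next (H.rev_rev _), ← h1, H.rev_rev]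
  by_cases h2 : H.rev d = H.next e
  · rw [h.suppressRev_of_eq_next h2, suppressRev_of_eq (H.rev_rev _), ← h2, H.rev_rev]
  · rw [suppressRev_of_ne h1 h2, suppressRev_of_src_ne (by rwa [H.rev_rev]), H.rev_rev]

theorem src_suppressRev_ne_src (h : H.IsSuppressible e) (d : H.D) :
    H.src (H.suppressRev e d) ≠ H.src d := by
  by_cases h1 : H.rev d = e
  · obtain rfl : d = H.rev e := by rw [← h1, H.rev_rev]
    rw [suppressRev_of_eq h1]
    exact h.src_ne.symm
  by_cases h2 : H.rev d = H.next e
  · obtain rfl : d = H.rev (H.next e) := by rw [← h2, H.rev_rev]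
    rw [h.suppressRev_of_eq_next h2]
    exact h.src_ne
  · rw [suppressRev_of_ne h1 h2]
    exact H.loopless d

end IsSuppressible

/-- The embedded graph obtained by suppressing the source of `e`, a vertex of degree two. -/
noncomputable def suppress (H : EmbeddedGraph.{u}) (e : H.D) (h : H.IsSuppressible e) :
    EmbeddedGraph.{u} where
  V := {v : H.V // v ≠ H.src e}
  D := {d : H.D // H.src d ≠ H.src e}
  src d := ⟨H.src d.1, d.2⟩
  rev d := ⟨H.suppressRev e d.1, h.src_suppressRev_ne d.1⟩
  rev_rev d := Subtype.ext (h.suppressRev_suppressRev d.2)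
  rev_ne d hd := h.src_suppressRev_ne_src d.1 (congrArg (fun x => H.src x.1) hd)
  loopless d hd := h.src_suppressRev_ne_src d.1 (congrArg Subtype.val hd)
  next := H.next.subtypePerm fun d => by rw [H.src_next]
  sameCycle_next d e := by
    rw [Equiv.Perm.sameCycle_subtypePerm, H.sameCycle_next, Subtype.ext_iff]

section Faces

variable (h : H.IsSuppressible e)

theorem suppress_facePerm (d : (H.suppress e h).D) :
    ((H.suppress e h).facePerm d).1 = H.next (H.suppressRev e d.1) := rfl

theorem suppress_facePerm_of_src_eq {d : (H.suppress e h).D}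
    (hd : H.src (H.facePerm d.1) = H.src e) :
    ((H.suppress e h).facePerm d).1 = H.facePerm (H.facePerm d.1) := by
  rw [H.src_facePerm] at hd
  rw [suppress_facePerm, H.facePerm_apply (H.facePerm d.1), H.facePerm_apply d.1]
  rcases h.eq_or_eq hd with h1 | h1
  · rw [suppressRev_of_eq h1, h1]
  · rw [h.suppressRev_of_eq_next h1, h1, h.next_next]

theorem suppress_facePerm_of_src_ne {d : (H.suppress e h).D}
    (hd : H.src (H.facePerm d.1) ≠ H.src e) :
    ((H.suppress e h).facePerm d).1 = H.facePerm d.1 := by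
  rw [H.src_facePerm] at hd
  rw [suppress_facePerm, suppressRev_of_src_ne hd, H.facePerm_apply]

theorem face_suppress_facePerm (d : (H.suppress e h).D) :
    H.face ((H.suppress e h).facePerm d).1 = H.face d.1 := by
  by_cases hd : H.src (H.facePerm d.1) = H.src e
  · rw [suppress_facePerm_of_src_eq h hd, H.face_facePerm, H.face_facePerm]
  · rw [suppress_facePerm_of_src_ne h hd, H.face_facePerm]

theorem src_facePerm_ne_of_src_eq {d : H.D} (hd : H.src d = H.src e) :
    H.src (H.facePerm d) ≠ H.src e := by
  rw [H.src_facePerm, ← hd]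
  exact H.loopless d

open Classical in
/-- The dart of the suppressed graph that replaces `d` on the boundary of its face: a dart leaving
the suppressed vertex is replaced by its successor. -/
noncomputable def suppressDart (d : H.D) : (H.suppress e h).D :=
  if hd : H.src d = H.src e then ⟨H.facePerm d, src_facePerm_ne_of_src_eq hd⟩ else ⟨d, hd⟩

theorem suppressDart_of_src_eq {d : H.D} (hd : H.src d = H.src e) :
    suppressDart h d = ⟨H.facePerm d, src_facePerm_ne_of_src_eq hd⟩ := dif_pos hd

theorem suppressDart_of_src_ne {d : H.D} (hd : H.src d ≠ H.src e) :
    suppressDart h d = ⟨d, hd⟩ := dif_neg hd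

theorem face_suppressDart (d : H.D) : H.face (suppressDart h d).1 = H.face d := by
  by_cases hd : H.src d = H.src e
  · rw [suppressDart_of_src_eq h hd, H.face_facePerm]
  · rw [suppressDart_of_src_ne h hd]

theorem suppress_face_suppressDart_facePerm (d : H.D) :
    (H.suppress e h).face (suppressDart h (H.facePerm d)) =
      (H.suppress e h).face (suppressDart h d) := by
  by_cases hd : H.src d = H.src e
  · rw [suppressDart_of_src_eq h hd, suppressDart_of_src_ne h (src_facePerm_ne_of_src_eq hd)]
  rw [suppressDart_of_src_ne h hd, ← (H.suppress e h).face_facePerm ⟨d, hd⟩]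
  congr 1
  apply Subtype.ext
  by_cases hφ : H.src (H.facePerm d) = H.src e
  · rw [suppressDart_of_src_eq h hφ]
    exact (suppress_facePerm_of_src_eq h (d := ⟨d, hd⟩) hφ).symm
  · rw [suppressDart_of_src_ne h hφ]
    exact (suppress_facePerm_of_src_ne h (d := ⟨d, hd⟩) hφ).symm

/-- Suppressing a vertex of degree two does not change the faces. -/
noncomputable def suppressFaceEquiv : (H.suppress e h).Face ≃ H.Face where
  toFun := Quotient.lift (fun d => H.face d.1) fun _ _ hd =>
    (H.suppress e h).apply_eq_of_face_eq (f := fun d => H.face d.1) (face_suppress_facePerm h)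
      (Quotient.sound hd)
  invFun := Quotient.lift (fun d => (H.suppress e h).face (suppressDart h d)) fun _ _ hd =>
    H.apply_eq_of_face_eq (f := fun d => (H.suppress e h).face (suppressDart h d))
      (suppress_face_suppressDart_facePerm h) (Quotient.sound hd)
  left_inv := Quotient.ind fun d =>
    congrArg (H.suppress e h).face (suppressDart_of_src_ne h d.2)
  right_inv := Quotient.ind (face_suppressDart h)

end Faces

section Connected

variable (h : H.IsSuppressible e)

open Classical in
/-- The contraction of the edge of `e` on vertices: the suppressed vertex is sent to the neighbour
at the other end of `e`. -/
noncomputable def suppressVertex (v : H.V) : (H.suppress e h).V :=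
  if hv : v = H.src e then ⟨H.src (H.rev e), H.loopless e⟩ else ⟨v, hv⟩

theorem suppressVertex_src : suppressVertex h (H.src e) = ⟨H.src (H.rev e), H.loopless e⟩ :=
  dif_pos rfl

theorem suppressVertex_of_ne {v : H.V} (hv : v ≠ H.src e) : suppressVertex h v = ⟨v, hv⟩ :=
  dif_neg hv

theorem reachable_suppressVertex_of_src_eq {d : H.D} (hd : H.src d = H.src e) :
    (H.suppress e h).toSimple.Reachable (suppressVertex h (H.src d))
      (suppressVertex h (H.src (H.rev d))) := by
  rcases h.eq_or_eq hd with rfl | rfl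
  · rw [suppressVertex_src, suppressVertex_of_ne h (H.loopless _)]
    exact SimpleGraph.Reachable.refl _
  · rw [H.src_next, suppressVertex_src,
      suppressVertex_of_ne h (H.src_rev_next_ne e)]
    exact SimpleGraph.Adj.reachable ⟨⟨H.rev e, H.loopless e⟩, rfl,
      Subtype.ext (congrArg H.src (suppressRev_of_eq (H.rev_rev e)))⟩

theorem reachable_suppressVertex (d : H.D) :
    (H.suppress e h).toSimple.Reachable (suppressVertex h (H.src d))
      (suppressVertex h (H.src (H.rev d))) := by
  by_cases hd : H.src d = H.src e
  · exact reachable_suppressVertex_of_src_eq h hd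
  by_cases hd' : H.src (H.rev d) = H.src e
  · simpa only [H.rev_rev] using (reachable_suppressVertex_of_src_eq h hd').symm
  · rw [suppressVertex_of_ne h hd, suppressVertex_of_ne h hd']
    exact SimpleGraph.Adj.reachable ⟨⟨d, hd⟩, rfl,
      Subtype.ext (congrArg H.src (suppressRev_of_src_ne hd'))⟩

theorem connected_suppress (hH : H.toSimple.Connected) : (H.suppress e h).toSimple.Connected where
  preconnected v w := by
    have hvw : (H.suppress e h).toSimple.Reachable (suppressVertex h v.1) (suppressVertex h w.1) :=
      reachable_map_of_adj (by rintro _ _ ⟨d, rfl, rfl⟩; exact reachable_suppressVertex h d)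
        (hH.preconnected v.1 w.1)
    rwa [suppressVertex_of_ne h v.2, suppressVertex_of_ne h w.2] at hvw
  nonempty := ⟨⟨H.src (H.rev e), H.loopless e⟩⟩

end Connected

section Card

variable (h : H.IsSuppressible e)

theorem src_cond_next (H : EmbeddedGraph.{u}) (e : H.D) (b : Bool) :
    H.src (cond b (H.next e) e) = H.src e := by
  cases b
  exacts [rfl, H.src_next e]

/-- The darts of `H` are the remaining darts and the two darts leaving the suppressed vertex. -/
noncomputable def suppressDartEquiv : (H.suppress e h).D ⊕ Bool ≃ H.D :=
  Equiv.ofBijective (Sum.elim Subtype.val fun b => cond b (H.next e) e) <| by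
    refine ⟨Subtype.val_injective.sumElim (Bool.injective_iff.2 h.next_ne.symm) fun d b hd =>
      d.2 (hd ▸ H.src_cond_next e b), fun d => ?_⟩
    by_cases hd : H.src d = H.src e
    · rcases h.eq_or_eq hd with rfl | rfl
      exacts [⟨Sum.inr false, rfl⟩, ⟨Sum.inr true, rfl⟩]
    · exact ⟨Sum.inl ⟨d, hd⟩, rfl⟩

open Classical in
/-- The vertices of `H` are the remaining vertices and the suppressed vertex. -/
noncomputable def suppressVertexEquiv : Option (H.suppress e h).V ≃ H.V :=
  Equiv.optionSubtypeNe (H.src e)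

open Classical in
theorem suppressVertexEquiv_none : suppressVertexEquiv h none = H.src e :=
  Equiv.optionSubtypeNe_none (H.src e)

theorem card_suppress_dart_add_two : Nat.card (H.suppress e h).D + 2 = Nat.card H.D := by
  rw [← Nat.card_congr (suppressDartEquiv h), Nat.card_sum, Nat.card_eq_fintype_card (α := Bool),
    Fintype.card_bool]

theorem card_suppress_vertex_add_one : Nat.card (H.suppress e h).V + 1 = Nat.card H.V := by
  rw [← Nat.card_congr (suppressVertexEquiv h), Finite.card_option]

end Card

end EmbeddedGraph

namespace PlaneGraph

variable {H : PlaneGraph.{u}} {e : H.D}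

/-- The plane graph obtained by suppressing the source of `e`, a vertex of degree two. -/
noncomputable def suppress (H : PlaneGraph.{u}) (e : H.D) (h : H.IsSuppressible e) :
    PlaneGraph.{u} where
  toEmbeddedGraph := H.toEmbeddedGraph.suppress e h
  connected := EmbeddedGraph.connected_suppress h H.connected
  euler := by
    linarith [(H.toEmbeddedGraph.suppress e h).card_darts,
      H.two_mul_card_add_two_mul_card_face, EmbeddedGraph.card_suppress_dart_add_two h,
      EmbeddedGraph.card_suppress_vertex_add_one h,
      Nat.card_congr (EmbeddedGraph.suppressFaceEquiv h)]
  outer := (EmbeddedGraph.suppressFaceEquiv h).symm H.outer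

theorem isEdgeSubdivision_suppress (h : H.IsSuppressible e) :
    (H.suppress e h).IsEdgeSubdivision H := by
  have hrev : H.suppressRev e (H.rev e) = H.rev (H.next e) :=
    EmbeddedGraph.suppressRev_of_eq (H.rev_rev e)
  refine ⟨EmbeddedGraph.suppressVertexEquiv h, EmbeddedGraph.suppressDartEquiv h,
    ⟨H.rev e, H.loopless e⟩, fun _ => rfl, (EmbeddedGraph.suppressVertexEquiv_none h).symm,
    (H.src_next e).trans (EmbeddedGraph.suppressVertexEquiv_none h).symm, H.rev_rev e,
    (congrArg H.rev hrev).trans (H.rev_rev _), fun x hx hx' => ?_, fun _ => rfl, fun x => ?_⟩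
  · have hx_rev : H.rev (H.rev x.1) = x.1 := H.rev_rev x.1
    refine (EmbeddedGraph.suppressRev_of_ne (fun hxe => hx ?_) fun hxe => hx' ?_).symm
    · exact Subtype.ext (hx_rev.symm.trans (congrArg H.rev hxe))
    · exact Subtype.ext ((hx_rev.symm.trans (congrArg H.rev hxe)).trans hrev.symm)
  · change H.face x.1 = H.outer ↔
      (H.toEmbeddedGraph.suppress e h).face x = (EmbeddedGraph.suppressFaceEquiv h).symm H.outer
    rw [Equiv.eq_symm_apply]
    rfl

theorem suppress_next_ne (h : H.IsSuppressible e) (hn : ∀ d, H.next d ≠ d)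
    (d : (H.suppress e h).D) : (H.suppress e h).next d ≠ d :=
  fun hd => hn d.1 (congrArg Subtype.val hd)

end PlaneGraph

theorem exists_separation_of_not_connected {V : Type*} {G : SimpleGraph V} {S : Set V}
    (hS : Sᶜ.Nonempty) (hG : ¬ (G.induce Sᶜ).Connected) :
    ∃ K : Set V, K.Nonempty ∧ Disjoint K S ∧ (K ∪ S)ᶜ.Nonempty ∧
      ∀ v ∈ K, ∀ w, G.Adj v w → w ∈ K ∪ S := by
  have : Nonempty (Sᶜ : Set V) := hS.to_subtype
  have hpre : ¬ (G.induce Sᶜ).Preconnected := fun h => hG ⟨h⟩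
  simp only [SimpleGraph.Preconnected, not_forall] at hpre
  obtain ⟨a, b, hab⟩ := hpre
  refine ⟨{w | ∃ hw : w ∈ Sᶜ, (G.induce Sᶜ).Reachable a ⟨w, hw⟩}, ⟨a, a.2, .refl a⟩,
    Set.disjoint_left.2 fun w hw => hw.1, ⟨b, ?_⟩, ?_⟩
  · rintro (⟨_, hb⟩ | hb)
    exacts [hab hb, b.2 hb]
  · rintro v ⟨hv, hreach⟩ w hvw
    by_cases hw : w ∈ S
    · exact Or.inr hw
    · exact Or.inl ⟨hw, hreach.trans (SimpleGraph.Adj.reachable hvw)⟩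

theorem exists_subset_pair {α : Type*} [Finite α] [Nonempty α] {S : Set α} (hS : S.ncard < 3) :
    ∃ x y, S ⊆ {x, y} := by
  obtain ⟨a⟩ := ‹Nonempty α›
  obtain h | h | h : S.ncard = 0 ∨ S.ncard = 1 ∨ S.ncard = 2 := by lia
  · exact ⟨a, a, ((Set.ncard_eq_zero (Set.toFinite _)).1 h).subset.trans (Set.empty_subset _)⟩
  · obtain ⟨x, rfl⟩ := Set.ncard_eq_one.1 h
    exact ⟨x, x, Set.subset_insert x {x}⟩
  · obtain ⟨x, y, -, rfl⟩ := Set.ncard_eq_two.1 h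
    exact ⟨x, y, subset_rfl⟩

namespace PlaneGraph

variable {G : PlaneGraph.{u}}

theorem src_surjective (G : PlaneGraph.{u}) : Function.Surjective G.src := by
  intro w
  obtain ⟨d, -⟩ := G.face_surjective G.outer
  have hw := G.connected.preconnected (G.src d) w
  rw [SimpleGraph.reachable_iff_reflTransGen] at hw
  cases hw with
  | refl => exact ⟨d, rfl⟩
  | tail _ h =>
    obtain ⟨e, -, rfl⟩ := h
    exact ⟨G.rev e, rfl⟩

section DegreeThree

variable (hn : ∀ d, G.next d ≠ d) (hnn : ∀ d, G.next (G.next d) ≠ d)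

include hn hnn

theorem three_le_ncard_src_eq (v : G.V) : 3 ≤ {d | G.src d = v}.ncard := by
  obtain ⟨d, rfl⟩ := G.src_surjective v
  have hcard : ({d, G.next d, G.next (G.next d)} : Set G.D).ncard = 3 :=
    Set.ncard_eq_three.2 ⟨_, _, _, (hn d).symm, (hnn d).symm, (hn _).symm, rfl⟩
  rw [← hcard]
  refine Set.ncard_le_ncard ?_ (Set.toFinite _)
  rintro _ (rfl | rfl | rfl)
  exacts [rfl, G.src_next d, (G.src_next _).trans (G.src_next d)]

theorem three_le_ncard_neighborSet (hs : G.IsSimple) (v : G.V) :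
    3 ≤ (G.toSimple.neighborSet v).ncard := by
  have hinj : Set.InjOn (fun d => G.src (G.rev d)) {d | G.src d = v} :=
    fun d hd e he h => hs d e (Eq.trans hd (Eq.symm he)) h
  rw [show G.toSimple.neighborSet v = (fun d => G.src (G.rev d)) '' {d | G.src d = v} from rfl,
    hinj.ncard_image]
  exact three_le_ncard_src_eq hn hnn v

theorem three_mul_ncard_le (K : Set G.V) : 3 * K.ncard ≤ {d | G.src d ∈ K}.ncard := by
  induction K, Set.toFinite K using Set.Finite.induction_on with
  | empty => simp
  | @insert v K hv _ ih =>
    have hdisj : Disjoint {d | G.src d = v} {d | G.src d ∈ K} :=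
      Set.disjoint_left.2 fun d hd hdK => hv (Eq.subst hd hdK)
    have hunion : {d | G.src d ∈ insert v K} = {d | G.src d = v} ∪ {d | G.src d ∈ K} := rfl
    rw [hunion, Set.ncard_union_eq hdisj (Set.toFinite _) (Set.toFinite _),
      Set.ncard_insert_of_notMem hv (Set.toFinite _)]
    linarith [three_le_ncard_src_eq hn hnn v]

theorem four_le_card (hs : G.IsSimple) : 4 ≤ Nat.card G.V := by
  obtain ⟨d, -⟩ := G.face_surjective G.outer
  have hinsert := Set.ncard_insert_of_notMem (G.toSimple.notMem_neighborSet_self (a := G.src d))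
    (Set.toFinite _)
  linarith [three_le_ncard_neighborSet hn hnn hs (G.src d),
    Set.ncard_le_card (insert (G.src d) (G.toSimple.neighborSet (G.src d)))]

variable {K S : Set G.V}

theorem two_le_ncard_of_adj (hs : G.IsSimple) (hK : K.Nonempty) (hS : S.ncard < 3)
    (hadj : ∀ v ∈ K, ∀ w, G.toSimple.Adj v w → w ∈ K ∪ S) : 2 ≤ K.ncard := by
  obtain ⟨v, hv⟩ := hK
  obtain ⟨w, hvw, hwS⟩ : ∃ w, G.toSimple.Adj v w ∧ w ∉ S := by
    by_contra! hcon
    have := Set.ncard_le_ncard (s := G.toSimple.neighborSet v) hcon (Set.toFinite _)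
    linarith [three_le_ncard_neighborSet hn hnn hs v]
  have hw : w ∈ K := (hadj v hv w hvw).resolve_right hwS
  rw [← Set.ncard_pair hvw.ne]
  exact Set.ncard_le_ncard (Set.pair_subset hv hw) (Set.toFinite _)

-- The darts leaving `K` number at least `3 |K| ≥ 2 |K| + 2`, and each of the at most two vertices
-- of `S` that meet `B` adds at least one dart.
theorem two_mul_ncard_src_le (hs : G.IsSimple) {B : Set G.D} (hK : K.Nonempty) (hS : S.ncard < 3)
    (hKS : Disjoint K S) (hr : ∀ d ∈ B, G.rev d ∈ B) (hKB : ∀ d, G.src d ∈ K → d ∈ B)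
    (hB : ∀ d ∈ B, G.src d ∈ K ∪ S) : 2 * (G.src '' B).ncard ≤ B.ncard := by
  have hK2 : 2 ≤ K.ncard := by
    refine two_le_ncard_of_adj hn hnn hs hK hS ?_
    rintro _ hv _ ⟨d, rfl, rfl⟩
    exact hB _ (hr d (hKB d hv))
  have hK3 : 3 * K.ncard ≤ {d | G.src d ∈ K}.ncard := three_mul_ncard_le hn hnn K
  set B' : Set G.D := {d | d ∈ B ∧ G.src d ∈ S}
  have hdarts : {d | G.src d ∈ K}.ncard + B'.ncard ≤ B.ncard := by
    have hdisj : Disjoint {d | G.src d ∈ K} B' :=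
      Set.disjoint_left.2 fun d hd hd' => Set.disjoint_left.1 hKS hd hd'.2
    rw [← Set.ncard_union_eq hdisj (Set.toFinite _) (Set.toFinite _)]
    exact Set.ncard_le_ncard (Set.union_subset hKB fun d hd => hd.1) (Set.toFinite _)
  have hvertices : (G.src '' B).ncard ≤ K.ncard + (G.src '' B').ncard := by
    refine (Set.ncard_le_ncard ?_ (Set.toFinite _)).trans (Set.ncard_union_le _ _)
    rintro _ ⟨d, hd, rfl⟩
    exact (hB d hd).imp_right fun hdS => ⟨d, ⟨hd, hdS⟩, rfl⟩
  have hsrcB' : (G.src '' B').ncard ≤ B'.ncard := Set.ncard_image_le (Set.toFinite _)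
  have hsrcB'S : (G.src '' B').ncard ≤ S.ncard :=
    Set.ncard_le_ncard (Set.image_subset_iff.2 fun d hd => hd.2) (Set.toFinite _)
  lia

theorem isDegenerate_of_separation (hs : G.IsSimple) (hS : S.ncard < 3) (hK : K.Nonempty)
    (hKS : Disjoint K S) (hKc : (K ∪ S)ᶜ.Nonempty)
    (hadj : ∀ v ∈ K, ∀ w, G.toSimple.Adj v w → w ∈ K ∪ S) : G.IsDegenerate := by
  set A : Set G.D := {d | G.src d ∈ K ∨ G.src (G.rev d) ∈ K}
  have hrev : ∀ d, G.rev d ∈ A ↔ d ∈ A := fun d => by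
    simp only [A, Set.mem_ofPred_eq, G.rev_rev, or_comm]
  have hA : ∀ d ∈ A, G.src d ∈ K ∪ S := by
    rintro d (hd | hd)
    · exact Or.inl hd
    · exact hadj _ hd _ ⟨G.rev d, rfl, by rw [G.rev_rev]⟩
  have hAc : ∀ d ∉ A, G.src d ∈ (K ∪ S)ᶜ ∪ S := fun d hd => by
    by_cases hdS : G.src d ∈ S
    · exact Or.inr hdS
    · exact Or.inl fun h => h.elim (fun hdK => hd (Or.inl hdK)) hdS
  obtain ⟨v, hv⟩ := hK
  obtain ⟨w, hw⟩ := hKc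
  obtain ⟨d, rfl⟩ := G.src_surjective v
  obtain ⟨e, rfl⟩ := G.src_surjective w
  have : Nonempty G.V := ⟨G.src d⟩
  obtain ⟨x, y, hxy⟩ := exists_subset_pair hS
  refine ⟨A, x, y, ⟨hrev, fun a ha b hb hab => hxy ?_⟩, ⟨d, Or.inl hv⟩,
    ⟨e, fun he => hw (hA e he)⟩, ?_, ?_⟩
  · exact (hA a ha).resolve_left fun haK => hb (Or.inl (hab ▸ haK))
  · exact two_mul_ncard_src_le hn hnn hs ⟨_, hv⟩ hS hKS (fun a => (hrev a).2)
      (fun a => Or.inl) hA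
  · exact two_mul_ncard_src_le hn hnn hs ⟨_, hw⟩ hS
      (disjoint_compl_left.mono_right Set.subset_union_right)
      (fun a ha h => ha ((hrev a).1 h)) (fun a ha h => ha (hA a h)) hAc

theorem isThreeConnected_of_not_isDegenerate (hs : G.IsSimple) (hdeg : ¬ G.IsDegenerate) :
    G.IsThreeConnected := by
  have hV : 4 ≤ Nat.card G.V := four_le_card hn hnn hs
  refine ⟨hV, fun S hS => by_contra fun hcon => hdeg ?_⟩
  have hSc : Sᶜ.Nonempty :=
    Set.nonempty_of_ncard_ne_zero (by have := Set.ncard_add_ncard_compl S; lia)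
  obtain ⟨K, hK, hKS, hKc, hadj⟩ := exists_separation_of_not_connected hSc hcon
  exact isDegenerate_of_separation hn hnn hs hS hK hKS hKc hadj

end DegreeThree

theorem isSimple_of_not_isDegenerate (hF : 4 ≤ Nat.card G.Face) (hdeg : ¬ G.IsDegenerate) :
    G.IsSimple :=
  fun _ _ hs ht => by_contra fun hne => hdeg (isDegenerate_of_parallel hF hne hs ht)

theorem isSuppressible_of_not_isDegenerate (hF : 4 ≤ Nat.card G.Face) (hn : ∀ d, G.next d ≠ d)
    (hdeg : ¬ G.IsDegenerate) {e : G.D} (he : G.next (G.next e) = e) : G.IsSuppressible e :=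
  ⟨he, hn e, fun h => hdeg (isDegenerate_of_parallel hF (hn e).symm (G.src_next e).symm h)⟩

theorem exists_isSubdivisionOf (G : PlaneGraph.{u}) (hF : 4 ≤ Nat.card G.Face)
    (hn : ∀ d, G.next d ≠ d) (hdeg : ¬ G.IsDegenerate) :
    ∃ R : PlaneGraph.{u}, R.IsSimple ∧ R.IsThreeConnected ∧ G.IsSubdivisionOf R := by
  induction hc : Nat.card G.D using Nat.strong_induction_on generalizing G with
  | _ n ih =>
    by_cases hnn : ∀ d, G.next (G.next d) ≠ d
    · have hs := isSimple_of_not_isDegenerate hF hdeg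
      exact ⟨G, hs, isThreeConnected_of_not_isDegenerate hn hnn hs hdeg, .refl⟩
    · push Not at hnn
      obtain ⟨e, he⟩ := hnn
      have he' := isSuppressible_of_not_isDegenerate hF hn hdeg he
      have hsub := isEdgeSubdivision_suppress he'
      obtain ⟨R, hR, hR', hGR⟩ := ih (Nat.card (G.suppress e he').D)
        (by have := hsub.card_dart; lia) (G.suppress e he') (hsub.card_face ▸ hF)
        (suppress_next_ne he' hn) (fun h => hdeg (hsub.isDegenerate h)) rfl
      exact ⟨R, hR, hR', hGR.tail hsub⟩

end PlaneGraph

theorem theorem2 (G : PlaneGraph.{u}) (hG : G.IsTwoConnected) (hF : 4 ≤ Nat.card G.Face) :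
    (∃ R : PlaneGraph.{u}, R.IsSimple ∧ R.IsThreeConnected ∧ G.IsSubdivisionOf R) ∨
      ∃ C : Cycle G.D, G.IsSeparatingCycle C ∧ C.length ≤ G.maxFaceDegree := by
  have hn : ∀ d, G.next d ≠ d := PlaneGraph.next_ne_of_isTwoConnected hG (by lia)
  by_cases hdeg : G.IsDegenerate
  · exact Or.inr (hdeg.hasShortSeparatingCycle hG hn)
  · exact Or.inl (G.exists_isSubdivisionOf hF hn hdeg)
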